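/- Let $\mathbb{H}$ be the quaternions and let $V$ be a finitely generated left $\mathbb{H}$-module with its standard topology (that of $\mathbb{H}^n\cong\mathbb{R}^{4n}$). A hyperplane in $V$ is the kernel of a non-zero $\mathbb{H}$-linear map $V\to\mathbb{H}$. Let $\mathcal{A}$ be a finite set of hyperplanes in $V$, and let $X=V\setminus\bigcup_{B\in\mathcal{A}}B$ be its complement. Write $H^i$ for singular cohomology with integer coefficients, with $H^i=0$ for $i<0$. (1) For $A\in\mathcal{A}$, let $X'\supseteq X$ be the complement in $V$ of the deletion $\mathcal{A}'=\mathcal{A}\setminus\{A\}$, and let $X''$ be the complement in $A$ of the restriction $\mathcal{A}''=\{B\cap A\mid B\in\mathcal{A}'\}$, a finite set of hyperplanes in the $\mathbb{H}$-module $A$. Then for every $A\in\mathcal{A}$ and every $i\in\mathbb{Z}$ there is a short exact sequence of abelian groups $$0\to H^i(X')\to H^i(X)\xrightarrow{\ \sigma\ }H^{i-3}(X'')\to 0,$$ in which the first map is induced by the inclusion $X\subseteq X'$. (2) If $i\in\mathbb{Z}$ is not a multiple of $3$, or $i<0$, or $i>3\dim_{\mathbb{H}}V$, then $H^i(X)=0$.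 -/

import Mathlib

open scoped Quaternion

universe u

noncomputable section

namespace QuaternionicArrangement

open CategoryTheory Opposite

/-- The integral singular cohomology `Hⁿ(-; ℤ)`, for `n : ℕ`, as a contravariant functor: the
`n`-th cohomology of the cochain complex `Hom(C_•(-; ℤ), ℤ)`, where `C_•(-; ℤ)` is the singular
chain complex. -/
def singularCohomologyNat (n : ℕ) : TopCat.{u}ᵒᵖ ⥤ AddCommGrpCat.{u} :=
  ((AlgebraicTopology.singularChainComplexFunctor AddCommGrpCat.{u}).obj
      (AddCommGrpCat.of (ULift.{u} ℤ))).op ⋙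
    HomologicalComplex.opFunctor AddCommGrpCat.{u} (ComplexShape.down ℕ) ⋙
    (preadditiveYoneda.obj (AddCommGrpCat.of (ULift.{u} ℤ))).mapHomologicalComplex
      (ComplexShape.down ℕ).symm ⋙
    HomologicalComplex.homologyFunctor AddCommGrpCat.{u} (ComplexShape.down ℕ).symm n

/-- Integral singular cohomology in all integral degrees; it is zero in negative degrees. -/
def singularCohomology : ℤ → (TopCat.{u}ᵒᵖ ⥤ AddCommGrpCat.{u})
  | Int.ofNat n => singularCohomologyNat n
  | Int.negSucc _ => (Functor.const _).obj (AddCommGrpCat.of PUnit)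

variable {V : Type u} [AddCommGroup V] [Module ℍ[ℝ] V]

/-- A (central) hyperplane: the kernel of a non-zero `ℍ`-linear map `V → ℍ`. -/
def IsHyperplane (A : Submodule ℍ[ℝ] V) : Prop :=
  ∃ a : V →ₗ[ℍ[ℝ]] ℍ[ℝ], a ≠ 0 ∧ LinearMap.ker a = A

theorem IsHyperplane.eq_of_le {A B : Submodule ℍ[ℝ] V} (hA : IsHyperplane A)
    (hB : IsHyperplane B) (h : A ≤ B) : A = B := by
  obtain ⟨a, ha, rfl⟩ := hA
  obtain ⟨b, hb, rfl⟩ := hB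
  refine le_antisymm h fun v hv => ?_
  by_contra hav
  rw [LinearMap.mem_ker] at hv hav
  refine hb (LinearMap.ext fun w => ?_)
  have hw : w - (a w * (a v)⁻¹) • v ∈ LinearMap.ker a := by
    rw [LinearMap.mem_ker, map_sub, map_smul, smul_eq_mul, mul_assoc, inv_mul_cancel₀ hav,
      mul_one, sub_self]
  have := h hw
  rwa [LinearMap.mem_ker, map_sub, map_smul, hv, smul_zero, sub_zero] at this

variable (V) in
/-- A hyperplane arrangement in `V`: a finite set of hyperplanes. -/
structure Arrangement where
  hyperplanes : Set (Submodule ℍ[ℝ] V)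
  finite : hyperplanes.Finite
  isHyperplane : ∀ A ∈ hyperplanes, IsHyperplane A

namespace Arrangement

/-- The complement `V ∖ ⋃ A`, the union being over the hyperplanes of the arrangement. -/
def complement (𝒜 : Arrangement V) : Set V :=
  (⋃ A ∈ 𝒜.hyperplanes, (A : Set V))ᶜ

/-- The deletion `𝒜' = 𝒜 ∖ {A}`. -/
def deletion (𝒜 : Arrangement V) (A : Submodule ℍ[ℝ] V) : Arrangement V where
  hyperplanes := 𝒜.hyperplanes \ {A}
  finite := 𝒜.finite.subset Set.sdiff_subset
  isHyperplane B hB := 𝒜.isHyperplane B hB.1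

/-- The restriction `𝒜'' = {B ∩ A | B ∈ 𝒜'}`, an arrangement in the module `A`. -/
def restriction (𝒜 : Arrangement V) (A : Submodule ℍ[ℝ] V) (hA : A ∈ 𝒜.hyperplanes) :
    Arrangement A where
  hyperplanes := (fun B => B.comap A.subtype) '' (𝒜.deletion A).hyperplanes
  finite := (𝒜.deletion A).finite.image _
  isHyperplane := by
    rintro _ ⟨B, ⟨hB, hne⟩, rfl⟩
    obtain ⟨b, hb, hbB⟩ := 𝒜.isHyperplane B hB
    refine ⟨b.comp A.subtype, fun h0 => hne ?_, ?_⟩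
    · refine ((𝒜.isHyperplane A hA).eq_of_le (𝒜.isHyperplane B hB) fun v hv => ?_).symm
      rw [← hbB, LinearMap.mem_ker]
      exact LinearMap.congr_fun h0 ⟨v, hv⟩
    · rw [LinearMap.ker_comp, hbB]

theorem complement_subset_deletion (𝒜 : Arrangement V) (A : Submodule ℍ[ℝ] V) :
    𝒜.complement ⊆ (𝒜.deletion A).complement :=
  Set.compl_subset_compl.mpr (Set.biUnion_subset_biUnion_left Set.sdiff_subset)

variable [TopologicalSpace V]

/-- The complement of an arrangement, as a topological space. -/
def space (𝒜 : Arrangement V) : TopCat.{u} := TopCat.of 𝒜.complement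

/-- The inclusion `X → X'` of the complement into the complement of the deletion. -/
def inclusion (𝒜 : Arrangement V) (A : Submodule ℍ[ℝ] V) :
    𝒜.space ⟶ (𝒜.deletion A).space :=
  TopCat.ofHom ⟨Set.inclusion (𝒜.complement_subset_deletion A), continuous_inclusion _⟩

end Arrangement

end QuaternionicArrangement

end

/-! Since `X = X' ∖ A` and the directions normal to `A` form a quaternionic line, `X'` looks near
`A` like `X'' × ℝ⁴`, and a Thom isomorphism gives `H^m(X', X) ≅ H^{m-4}(X'')`. Suppose that `X'` and
`X''` have cohomology only in degrees divisible by 3. Then `H^m(X', X) → H^m(X')` is zero for every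
`m`: if `3 ∤ m` the target vanishes, and if `3 ∣ m` then `3 ∤ m - 4` and the source vanishes. So the
long exact sequence of the pair falls apart into the short exact sequences of (1), with `σ` the
connecting map. Such a sequence puts `H^i(X)` between `H^i(X')` and `H^{i-3}(X'')`, which yields (2)
for `X`, as `dim A = dim V - 1`. Hence (2) follows by induction on the number of hyperplanes,
starting from the contractible space `V`, and (1) follows from (2) for the deletion and the
restriction.

Relative cohomology is built from the complexes `relCochain X 𝒰` of cochains vanishing on the
simplices that lie in a member of `𝒰`. The empty family gives all cochains, `{U}` gives the pair
`(X, U)`, and an open cover gives an acyclic complex (`relCochain_acyclic`, by barycentric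
subdivision). The last fact is excision (`quasiIso_relMap_of_isOpenEmbedding`). The Thom isomorphism
(`isHomologyShift_relCochain`) consists of four applications of `suspension` and of excision to an
open set common to `X'` and `X'' × ℝ⁴`. -/

noncomputable section

/-! ### Singular cochains as functions on simplices; homotopy invariance. -/

namespace SingularCochain

open CategoryTheory Opposite Simplicial

/-- The singular cochain complex `Hom(C_•(-; ℤ), ℤ)` as a contravariant functor. -/
def cochainFunctor :
    TopCat.{u}ᵒᵖ ⥤ HomologicalComplex AddCommGrpCat.{u} (ComplexShape.down ℕ).symm :=
  ((AlgebraicTopology.singularChainComplexFunctor AddCommGrpCat.{u}).obj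
      (AddCommGrpCat.of (ULift.{u} ℤ))).op ⋙
    HomologicalComplex.opFunctor AddCommGrpCat.{u} (ComplexShape.down ℕ) ⋙
    (preadditiveYoneda.obj (AddCommGrpCat.of (ULift.{u} ℤ))).mapHomologicalComplex
      (ComplexShape.down ℕ).symm

/-- The topological standard `n`-simplex. -/
abbrev Simplex (n : ℕ) : Type := stdSimplex ℝ (Fin (n + 1))

/-- The inclusion of the `i`-th face of the standard simplex. -/
def faceMap {n : ℕ} (i : Fin (n + 2)) : C(Simplex n, Simplex (n + 1)) :=
  ⟨stdSimplex.map i.succAbove, stdSimplex.continuous_map _⟩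

/-- The generator of the singular chains corresponding to a singular simplex. -/
def chainι (X : TopCat.{u}) {n : ℕ} (σ : C(Simplex n, X)) :
    AddCommGrpCat.of (ULift.{u} ℤ) ⟶
      (((AlgebraicTopology.singularChainComplexFunctor AddCommGrpCat.{u}).obj
      (AddCommGrpCat.of (ULift.{u} ℤ))).obj X).X n :=
  (TopCat.toSSet.obj X).ιChainComplex ((TopCat.toSSetObjEquiv X (op ⦋n⦌)).symm σ)

theorem chainι_d (X : TopCat.{u}) {n : ℕ} (σ : C(Simplex (n + 1), X)) :
    chainι X σ ≫ (((AlgebraicTopology.singularChainComplexFunctor AddCommGrpCat.{u}).obj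
      (AddCommGrpCat.of (ULift.{u} ℤ))).obj X).d (n + 1) n =
      ∑ i : Fin (n + 2), (-1 : ℤ) ^ (i : ℕ) • chainι X (σ.comp (faceMap i)) :=
  (TopCat.toSSet.obj X).ιChainComplex_d (R := AddCommGrpCat.of (ULift.{u} ℤ)) _

theorem chainι_map {X Y : TopCat.{u}} (f : X ⟶ Y) {n : ℕ} (σ : C(Simplex n, X)) :
    chainι X σ ≫ (((AlgebraicTopology.singularChainComplexFunctor AddCommGrpCat.{u}).obj
      (AddCommGrpCat.of (ULift.{u} ℤ))).map f).f n = chainι Y (f.hom.comp σ) :=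
  SSet.ι_chainComplexMap_f _ _ (TopCat.toSSet.map f) (AddCommGrpCat.of (ULift.{u} ℤ)) _

/-- Singular cochains are functions on singular simplices. -/
def ev (X : TopCat.{u}) (n : ℕ) :
    (cochainFunctor.obj (op X)).X n ≃+ (C(Simplex n, X) → ULift.{u} ℤ) where
  toFun φ σ := (chainι X σ ≫ (show (((AlgebraicTopology.singularChainComplexFunctor
      AddCommGrpCat.{u}).obj (AddCommGrpCat.of (ULift.{u} ℤ))).obj X).X n ⟶
      AddCommGrpCat.of (ULift.{u} ℤ) from φ)).hom ⟨1⟩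
  invFun f := Limits.Cofan.IsColimit.desc
    ((TopCat.toSSet.obj X).isColimitChainComplexXCofan (AddCommGrpCat.of (ULift.{u} ℤ)) n)
    fun x => AddCommGrpCat.ofHom
      ((zmultiplesHom _ (f (TopCat.toSSetObjEquiv X (op ⦋n⦌) x))).comp
        AddEquiv.ulift.toAddMonoidHom)
  left_inv φ := by
    refine SSet.chainComplex_hom_ext fun x => ?_
    refine (Limits.Cofan.IsColimit.fac _ _ _).trans ?_
    ext z
    have hx : (TopCat.toSSetObjEquiv X (op ⦋n⦌)).symm (TopCat.toSSetObjEquiv X (op ⦋n⦌) x) = x :=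
      Equiv.symm_apply_apply _ _
    have hz : z = z.down • (⟨1⟩ : ULift.{u} ℤ) := by ext; simp
    conv_rhs => rw [hz, map_zsmul]
    simp only [chainι, hx]
    rfl
  right_inv f := by
    funext σ
    simp only [chainι]
    erw [Limits.Cofan.IsColimit.fac]
    exact (congrArg (fun τ => (1 : ℤ) • f τ) (Equiv.apply_symm_apply _ σ)).trans (one_zsmul _)
  map_add' φ ψ := rfl

theorem hom_sum_zsmul_comp_apply {ι : Type*} [Fintype ι] {A B D : AddCommGrpCat.{u}}
    (c : ι → ℤ) (g : ι → (A ⟶ B)) (φ : B ⟶ D) (x : A) :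
    ((∑ i, c i • g i) ≫ φ).hom x = ∑ i, c i • (g i ≫ φ).hom x := by
  rw [Preadditive.sum_comp]
  let e : (A ⟶ D) →+ D := ⟨⟨fun f => f.hom x, rfl⟩, fun _ _ => rfl⟩
  refine (map_sum e _ _).trans (Finset.sum_congr rfl fun i _ => ?_)
  simp [e]

/-- Together with `ev_map` this lets the explicit cochain computations below work with functions on
singular simplices. -/
theorem ev_d (X : TopCat.{u}) (n : ℕ) (φ : (cochainFunctor.obj (op X)).X n)
    (σ : C(Simplex (n + 1), X)) :
    ev X (n + 1) ((cochainFunctor.obj (op X)).d n (n + 1) φ) σ =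
      ∑ i : Fin (n + 2), (-1 : ℤ) ^ (i : ℕ) • ev X n φ (σ.comp (faceMap i)) := by
  have h := congrArg (fun g => (g ≫ (show (((AlgebraicTopology.singularChainComplexFunctor
    AddCommGrpCat.{u}).obj (AddCommGrpCat.of (ULift.{u} ℤ))).obj X).X n ⟶
    AddCommGrpCat.of (ULift.{u} ℤ) from φ)).hom (⟨1⟩ : ULift.{u} ℤ)) (chainι_d X σ)
  exact h.trans (hom_sum_zsmul_comp_apply _ _ _ _)

theorem ev_map {X Y : TopCat.{u}} (f : X ⟶ Y) (n : ℕ) (φ : (cochainFunctor.obj (op Y)).X n)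
    (σ : C(Simplex n, X)) :
    ev X n ((cochainFunctor.map f.op).f n φ) σ = ev Y n φ (f.hom.comp σ) :=
  congrArg (fun g => (g ≫ (show (((AlgebraicTopology.singularChainComplexFunctor
    AddCommGrpCat.{u}).obj (AddCommGrpCat.of (ULift.{u} ℤ))).obj Y).X n ⟶
    AddCommGrpCat.of (ULift.{u} ℤ) from φ)).hom (⟨1⟩ : ULift.{u} ℤ)) (chainι_map f σ)

theorem cochainFunctor_map_homologyMap_eq {X Y : TopCat.{u}} {f g : X ⟶ Y}
    (H : TopCat.Homotopy f g) (n : ℕ) :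
    HomologicalComplex.homologyMap (cochainFunctor.map f.op) n =
      HomologicalComplex.homologyMap (cochainFunctor.map g.op) n :=
  (((preadditiveYoneda.obj (AddCommGrpCat.of (ULift.{u} ℤ))).mapHomotopy
    (H.singularChainComplexFunctorObjMap
      (AddCommGrpCat.of (ULift.{u} ℤ))).op)).homologyMap_eq n

theorem quasiIso_cochainFunctor_map {X Y : TopCat.{u}} (f : X ⟶ Y) (g : Y ⟶ X)
    (H : TopCat.Homotopy (f ≫ g) (𝟙 X)) (K : TopCat.Homotopy (g ≫ f) (𝟙 Y)) :
    QuasiIso (cochainFunctor.map f.op) := by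
  rw [quasiIso_iff]
  intro n
  rw [quasiIsoAt_iff_isIso_homologyMap]
  refine ⟨HomologicalComplex.homologyMap (cochainFunctor.map g.op) n, ?_, ?_⟩
  · rw [← HomologicalComplex.homologyMap_comp, ← Functor.map_comp, ← op_comp,
      cochainFunctor_map_homologyMap_eq K]
    simp
  · rw [← HomologicalComplex.homologyMap_comp, ← Functor.map_comp, ← op_comp,
      cochainFunctor_map_homologyMap_eq H]
    simp

end SingularCochain

end

/-! ### Barycentric subdivision of formal simplices. -/

noncomputable section

namespace SimplexSubdivision

variable {P Q : Type*}

/-- Formal integral combinations of `n`-tuples of points, viewed as (possibly degenerate)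
simplices with `n` vertices. -/
abbrev TupleChain (P : Type*) (n : ℕ) : Type _ := (Fin n → P) →₀ ℤ

/-- The linear extension of a map defined on generators. -/
abbrev linExt {α M : Type*} [AddCommGroup M] (f : α → M) : (α →₀ ℤ) →ₗ[ℤ] M :=
  Finsupp.linearCombination ℤ f

theorem linExt_single {α M : Type*} [AddCommGroup M] (f : α → M) (a : α) :
    linExt f (Finsupp.single a 1) = f a := by
  simp [linExt]

/-- The alternating sum of the faces. -/
def boundary (P : Type*) (n : ℕ) : TupleChain P (n + 1) →ₗ[ℤ] TupleChain P n :=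
  linExt fun p => ∑ i : Fin (n + 1), (-1 : ℤ) ^ (i : ℕ) • Finsupp.single (p ∘ i.succAbove) 1

/-- Adjoining a vertex in front. -/
def cone (x : P) (n : ℕ) : TupleChain P n →ₗ[ℤ] TupleChain P (n + 1) :=
  linExt fun p => Finsupp.single (Fin.cons x p) 1

/-- The map on chains induced by a map of points. -/
def mapChain (f : P → Q) (n : ℕ) : TupleChain P n →ₗ[ℤ] TupleChain Q n :=
  linExt fun p => Finsupp.single (f ∘ p) 1

theorem boundary_single {n : ℕ} (p : Fin (n + 1) → P) :
    boundary P n (Finsupp.single p 1) =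
      ∑ i : Fin (n + 1), (-1 : ℤ) ^ (i : ℕ) • Finsupp.single (p ∘ i.succAbove) 1 :=
  linExt_single _ _

theorem cone_single (x : P) {n : ℕ} (p : Fin n → P) :
    cone x n (Finsupp.single p 1) = Finsupp.single (Fin.cons x p) 1 :=
  linExt_single _ _

theorem mapChain_single (f : P → Q) {n : ℕ} (p : Fin n → P) :
    mapChain f n (Finsupp.single p 1) = Finsupp.single (f ∘ p) 1 :=
  linExt_single _ _

theorem linearMap_ext_single {α M : Type*} [AddCommGroup M] {f g : (α →₀ ℤ) →ₗ[ℤ] M}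
    (h : ∀ a, f (Finsupp.single a 1) = g (Finsupp.single a 1)) : f = g :=
  Finsupp.lhom_ext' fun a => LinearMap.ext_ring (h a)

/-- Deleting the apex gives back `c`. Deleting another vertex commutes with coning, but its position
has moved by one, which changes the sign. -/
theorem boundary_cone (x : P) (n : ℕ) (c : TupleChain P (n + 1)) :
    boundary P (n + 1) (cone x (n + 1) c) = c - cone x n (boundary P n c) := by
  suffices h : boundary P (n + 1) ∘ₗ cone x (n + 1) = LinearMap.id - cone x n ∘ₗ boundary P n from
    LinearMap.congr_fun h c
  refine linearMap_ext_single fun p => ?_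
  simp only [LinearMap.comp_apply, LinearMap.sub_apply, LinearMap.id_apply, cone_single,
    boundary_single, map_sum, map_zsmul]
  rw [Fin.sum_univ_succ, sub_eq_add_neg, ← Finset.sum_neg_distrib]
  congr 1
  · simp only [Fin.val_zero, pow_zero, one_smul]
    congr 1
  · refine Finset.sum_congr rfl fun i _ => ?_
    rw [Fin.val_succ, pow_succ, mul_neg_one, neg_smul]
    congr 3
    funext j
    refine Fin.cases ?_ (fun j => ?_) j <;> simp

/-- The index counts vertices, so degree 0 is spanned by the empty tuple and the complex is
augmented; at the bottom the cone formula has no correction term. -/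
theorem boundary_cone_zero (x : P) (c : TupleChain P 0) :
    boundary P 0 (cone x 0 c) = c := by
  suffices h : boundary P 0 ∘ₗ cone x 0 = LinearMap.id from LinearMap.congr_fun h c
  refine linearMap_ext_single fun p => ?_
  simp only [LinearMap.comp_apply, LinearMap.id_apply, cone_single, boundary_single]
  rw [Fin.sum_univ_one, Fin.val_zero, pow_zero, one_smul]
  congr 1

/-- Every nonempty tuple is the cone from its first vertex over its tail, so the cone formula lowers
the dimension by one. -/
theorem boundary_boundary (n : ℕ) (c : TupleChain P (n + 2)) :
    boundary P n (boundary P (n + 1) c) = 0 := by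
  suffices h : ∀ n, boundary P n ∘ₗ boundary P (n + 1) = 0 from LinearMap.congr_fun (h n) c
  intro n
  induction n with
  | zero =>
    refine linearMap_ext_single fun p => ?_
    have hp : Finsupp.single p (1 : ℤ) = cone (p 0) 1 (Finsupp.single (Fin.tail p) 1) := by
      rw [cone_single, Fin.cons_self_tail]
    rw [LinearMap.comp_apply, hp, boundary_cone, map_sub, boundary_cone_zero, sub_self]
    rfl
  | succ n ih =>
    refine linearMap_ext_single fun p => ?_
    have hp : Finsupp.single p (1 : ℤ) = cone (p 0) (n + 2) (Finsupp.single (Fin.tail p) 1) := by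
      rw [cone_single, Fin.cons_self_tail]
    have ih' := LinearMap.congr_fun ih (Finsupp.single (Fin.tail p) 1)
    rw [LinearMap.comp_apply] at ih'
    rw [LinearMap.comp_apply, hp, boundary_cone, map_sub, boundary_cone, ih']
    simp

theorem mapChain_boundary (f : P → Q) (n : ℕ) (c : TupleChain P (n + 1)) :
    mapChain f n (boundary P n c) = boundary Q n (mapChain f (n + 1) c) := by
  suffices h : mapChain f n ∘ₗ boundary P n = boundary Q n ∘ₗ mapChain f (n + 1) from
    LinearMap.congr_fun h c
  refine linearMap_ext_single fun p => ?_
  simp only [LinearMap.comp_apply, boundary_single, mapChain_single, map_sum, map_zsmul]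
  rfl

theorem mapChain_cone (f : P → Q) (x : P) (n : ℕ) (c : TupleChain P n) :
    mapChain f (n + 1) (cone x n c) = cone (f x) n (mapChain f n c) := by
  suffices h : mapChain f (n + 1) ∘ₗ cone x n = cone (f x) n ∘ₗ mapChain f n from
    LinearMap.congr_fun h c
  refine linearMap_ext_single fun p => ?_
  simp only [LinearMap.comp_apply, cone_single, mapChain_single]
  congr 1
  funext j
  refine Fin.cases ?_ (fun j => ?_) j <;> simp

variable (b : ∀ n : ℕ, (Fin (n + 1) → P) → P)

/-- Barycentric subdivision with respect to a choice `b` of an apex for each simplex. -/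
def subdivision : ∀ n : ℕ, TupleChain P n →ₗ[ℤ] TupleChain P n
  | 0 => LinearMap.id
  | n + 1 => linExt fun p =>
      cone (b n p) n (subdivision n (boundary P n (Finsupp.single p 1)))

/-- The chain homotopy between the identity and the subdivision. -/
def subdivisionHomotopy : ∀ n : ℕ, TupleChain P n →ₗ[ℤ] TupleChain P (n + 1)
  | 0 => 0
  | n + 1 => linExt fun p => cone (b n p) (n + 1)
      (Finsupp.single p 1 - subdivisionHomotopy n (boundary P n (Finsupp.single p 1)))

theorem subdivision_single (n : ℕ) (p : Fin (n + 1) → P) :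
    subdivision b (n + 1) (Finsupp.single p 1) =
      cone (b n p) n (subdivision b n (boundary P n (Finsupp.single p 1))) :=
  linExt_single _ _

theorem subdivisionHomotopy_single (n : ℕ) (p : Fin (n + 1) → P) :
    subdivisionHomotopy b (n + 1) (Finsupp.single p 1) = cone (b n p) (n + 1)
      (Finsupp.single p 1 - subdivisionHomotopy b n (boundary P n (Finsupp.single p 1))) :=
  linExt_single _ _

/-- Writing `S` for the subdivision, the cone formula leaves `S ∂p` minus the cone over `∂ S ∂p`,
and inductively `∂ S ∂p = S ∂ ∂p = 0`. -/
theorem boundary_subdivision (n : ℕ) (c : TupleChain P (n + 1)) :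
    boundary P n (subdivision b (n + 1) c) = subdivision b n (boundary P n c) := by
  suffices h : ∀ n, boundary P n ∘ₗ subdivision b (n + 1) = subdivision b n ∘ₗ boundary P n from
    LinearMap.congr_fun (h n) c
  intro n
  induction n with
  | zero =>
    refine linearMap_ext_single fun p => ?_
    rw [LinearMap.comp_apply, subdivision_single, boundary_cone_zero, LinearMap.comp_apply]
  | succ n ih =>
    refine linearMap_ext_single fun p => ?_
    have ih' := LinearMap.congr_fun ih (boundary P (n + 1) (Finsupp.single p 1))
    rw [LinearMap.comp_apply, LinearMap.comp_apply, boundary_boundary, map_zero] at ih'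
    rw [LinearMap.comp_apply, subdivision_single, boundary_cone, ih', map_zero, sub_zero,
      LinearMap.comp_apply]

/-- With `T` the homotopy, `∂ T p` is `p - T ∂p` minus the cone over `∂(p - T ∂p)`. Inductively the
latter boundary is `S ∂p`, and its cone is `S p`. -/
theorem boundary_subdivisionHomotopy (n : ℕ) (c : TupleChain P (n + 1)) :
    boundary P (n + 1) (subdivisionHomotopy b (n + 1) c) =
      c - subdivision b (n + 1) c - subdivisionHomotopy b n (boundary P n c) := by
  suffices h : ∀ n, boundary P (n + 1) ∘ₗ subdivisionHomotopy b (n + 1) =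
      LinearMap.id - subdivision b (n + 1) - subdivisionHomotopy b n ∘ₗ boundary P n from
    LinearMap.congr_fun (h n) c
  intro n
  induction n with
  | zero =>
    refine linearMap_ext_single fun p => ?_
    simp only [LinearMap.comp_apply, LinearMap.sub_apply, LinearMap.id_apply]
    rw [subdivisionHomotopy_single, boundary_cone, subdivision_single]
    simp [subdivisionHomotopy, subdivision]
  | succ n ih =>
    refine linearMap_ext_single fun p => ?_
    have ih' := LinearMap.congr_fun ih (boundary P (n + 1) (Finsupp.single p 1))
    simp only [LinearMap.comp_apply, LinearMap.sub_apply, LinearMap.id_apply, boundary_boundary,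
      map_zero, sub_zero] at ih'
    simp only [LinearMap.comp_apply, LinearMap.sub_apply, LinearMap.id_apply]
    rw [subdivisionHomotopy_single, boundary_cone, subdivision_single, map_sub (boundary P (n + 1)),
      ih', sub_sub_cancel]
    abel

/-- Used for affine maps, which respect barycenters; this makes subdivision of singular simplices
compatible with faces. -/
theorem mapChain_subdivision {b' : ∀ n : ℕ, (Fin (n + 1) → Q) → Q} {f : P → Q}
    (hf : ∀ n p, f (b n p) = b' n (f ∘ p)) (n : ℕ) (c : TupleChain P n) :
    mapChain f n (subdivision b n c) = subdivision b' n (mapChain f n c) := by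
  suffices h : ∀ n, mapChain f n ∘ₗ subdivision b n = subdivision b' n ∘ₗ mapChain f n from
    LinearMap.congr_fun (h n) c
  intro n
  induction n with
  | zero => rfl
  | succ n ih =>
    refine linearMap_ext_single fun p => ?_
    have ih' := LinearMap.congr_fun ih (boundary P n (Finsupp.single p 1))
    simp only [LinearMap.comp_apply] at ih' ⊢
    rw [subdivision_single, mapChain_cone, ih', mapChain_boundary, mapChain_single,
      subdivision_single, hf]

theorem mapChain_subdivisionHomotopy {b' : ∀ n : ℕ, (Fin (n + 1) → Q) → Q} {f : P → Q}
    (hf : ∀ n p, f (b n p) = b' n (f ∘ p)) (n : ℕ) (c : TupleChain P n) :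
    mapChain f (n + 1) (subdivisionHomotopy b n c) =
      subdivisionHomotopy b' n (mapChain f n c) := by
  suffices h : ∀ n, mapChain f (n + 1) ∘ₗ subdivisionHomotopy b n =
      subdivisionHomotopy b' n ∘ₗ mapChain f n from LinearMap.congr_fun (h n) c
  intro n
  induction n with
  | zero => simp [subdivisionHomotopy]
  | succ n ih =>
    refine linearMap_ext_single fun p => ?_
    have ih' := LinearMap.congr_fun ih (boundary P n (Finsupp.single p 1))
    simp only [LinearMap.comp_apply] at ih' ⊢
    rw [subdivisionHomotopy_single, mapChain_cone, map_sub, ih', mapChain_boundary,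
      mapChain_single, subdivisionHomotopy_single, hf]

end SimplexSubdivision

end

/-! ### Barycentric subdivision of singular chains. -/

noncomputable section

namespace SimplexSubdivision

open SingularCochain

/-- The affine simplex in `Simplex n` with prescribed vertices. -/
def affineSimplex {m n : ℕ} (p : Fin (m + 1) → Simplex n) : C(Simplex m, Simplex n) where
  toFun t := ⟨∑ i, t i • (p i : Fin (n + 1) → ℝ), (convex_stdSimplex ℝ _).sum_mem
    (fun i _ => t.2.1 i) t.2.2 fun i _ => (p i).2⟩
  continuous_toFun := by
    refine Continuous.subtype_mk (continuous_finsetSum _ fun i _ => ?_) _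
    exact ((continuous_apply i).comp continuous_subtype_val).smul continuous_const

theorem affineSimplex_apply {m n : ℕ} (p : Fin (m + 1) → Simplex n) (t : Simplex m)
    (k : Fin (n + 1)) : affineSimplex p t k = ∑ i, t i * p i k := by
  change (∑ i, t i • (p i : Fin (n + 1) → ℝ)) k = _
  rw [Finset.sum_apply]
  rfl

/-- The vertices of the standard simplex. -/
def vertices (n : ℕ) : Fin (n + 1) → Simplex n := fun i => stdSimplex.vertex i

theorem affineSimplex_vertices_apply {m n : ℕ} (p : Fin (m + 1) → Simplex n) (i : Fin (m + 1)) :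
    affineSimplex p (vertices m i) = p i := by
  ext k
  rw [affineSimplex_apply]
  simp [vertices, Pi.single_apply]

theorem affineSimplex_comp_vertices {m n : ℕ} (p : Fin (m + 1) → Simplex n) :
    affineSimplex p ∘ vertices m = p :=
  funext (affineSimplex_vertices_apply p)

theorem affineSimplex_vertices (n : ℕ) :
    affineSimplex (vertices n) = ContinuousMap.id (Simplex n) := by
  ext t k
  rw [affineSimplex_apply]
  simp [vertices, Pi.single_apply]

theorem affineSimplex_comp {k m n : ℕ} (p : Fin (m + 1) → Simplex n)
    (q : Fin (k + 1) → Simplex m) :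
    (affineSimplex p).comp (affineSimplex q) = affineSimplex (affineSimplex p ∘ q) := by
  ext t l
  simp only [ContinuousMap.comp_apply, affineSimplex_apply, Function.comp_apply, Finset.sum_mul,
    Finset.mul_sum, mul_assoc]
  exact Finset.sum_comm

theorem faceMap_eq {n : ℕ} (i : Fin (n + 2)) :
    faceMap i = affineSimplex (vertices (n + 1) ∘ i.succAbove) := by
  ext t k
  rw [affineSimplex_apply]
  simp [faceMap, vertices, Pi.single_apply, FunOnFinite.linearMap_apply_apply,
    Finset.sum_filter, eq_comm]

theorem affineSimplex_comp_faceMap {m n : ℕ} (p : Fin (m + 2) → Simplex n) (i : Fin (m + 2)) :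
    (affineSimplex p).comp (faceMap i) = affineSimplex (p ∘ i.succAbove) := by
  rw [faceMap_eq, affineSimplex_comp]
  congr 1
  funext j
  exact affineSimplex_vertices_apply p _

/-- The barycenter of an affine simplex. -/
def barycenter (n m : ℕ) (p : Fin (m + 1) → Simplex n) : Simplex n :=
  affineSimplex p stdSimplex.barycenter

theorem affineSimplex_barycenter {k n : ℕ} (p : Fin (k + 1) → Simplex n) (m : ℕ)
    (q : Fin (m + 1) → Simplex k) :
    affineSimplex p (barycenter k m q) = barycenter n m (affineSimplex p ∘ q) := by
  rw [barycenter, barycenter, ← affineSimplex_comp]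
  rfl

variable {X : Type*} [TopologicalSpace X]

variable (X) in
/-- Singular chains. -/
abbrev SingularChain (n : ℕ) : Type _ := C(Simplex n, X) →₀ ℤ

variable (X) in
/-- The boundary of singular chains. -/
def singularBoundary (n : ℕ) : SingularChain X (n + 1) →ₗ[ℤ] SingularChain X n :=
  linExt fun σ => ∑ i : Fin (n + 2), (-1 : ℤ) ^ (i : ℕ) • Finsupp.single (σ.comp (faceMap i)) 1

theorem singularBoundary_single {n : ℕ} (σ : C(Simplex (n + 1), X)) :
    singularBoundary X n (Finsupp.single σ 1) =
      ∑ i : Fin (n + 2), (-1 : ℤ) ^ (i : ℕ) • Finsupp.single (σ.comp (faceMap i)) 1 :=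
  linExt_single _ _

/-- The singular chain in `X` given by a formal combination of affine simplices in `Simplex n`
and a singular simplex of `X`. -/
def realize {n : ℕ} (σ : C(Simplex n, X)) (m : ℕ) :
    TupleChain (Simplex n) (m + 1) →ₗ[ℤ] SingularChain X m :=
  linExt fun p => Finsupp.single (σ.comp (affineSimplex p)) 1

theorem realize_single {n : ℕ} (σ : C(Simplex n, X)) {m : ℕ} (p : Fin (m + 1) → Simplex n) :
    realize σ m (Finsupp.single p 1) = Finsupp.single (σ.comp (affineSimplex p)) 1 :=
  linExt_single _ _

theorem realize_vertices {n : ℕ} (σ : C(Simplex n, X)) :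
    realize σ n (Finsupp.single (vertices n) 1) = Finsupp.single σ 1 := by
  rw [realize_single, affineSimplex_vertices, ContinuousMap.comp_id]

theorem singularBoundary_realize {n : ℕ} (σ : C(Simplex n, X)) (m : ℕ)
    (c : TupleChain (Simplex n) (m + 2)) :
    singularBoundary X m (realize σ (m + 1) c) = realize σ m (boundary _ (m + 1) c) := by
  suffices h : singularBoundary X m ∘ₗ realize σ (m + 1) = realize σ m ∘ₗ boundary _ (m + 1) from
    LinearMap.congr_fun h c
  refine linearMap_ext_single fun p => ?_
  simp only [LinearMap.comp_apply, realize_single, singularBoundary_single, boundary_single,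
    map_sum, map_zsmul, ContinuousMap.comp_assoc, affineSimplex_comp_faceMap]

theorem realize_comp_affineSimplex {k n : ℕ} (σ : C(Simplex n, X)) (p : Fin (k + 1) → Simplex n)
    (m : ℕ) (c : TupleChain (Simplex k) (m + 1)) :
    realize (σ.comp (affineSimplex p)) m c = realize σ m (mapChain (affineSimplex p) (m + 1) c) := by
  suffices h : realize (σ.comp (affineSimplex p)) m =
      realize σ m ∘ₗ mapChain (affineSimplex p) (m + 1) from LinearMap.congr_fun h c
  refine linearMap_ext_single fun q => ?_
  simp only [LinearMap.comp_apply, realize_single, mapChain_single, ContinuousMap.comp_assoc,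
    affineSimplex_comp]

variable (X) in
/-- Barycentric subdivision of singular chains. -/
def singularSubdivision (n : ℕ) : SingularChain X n →ₗ[ℤ] SingularChain X n :=
  linExt fun σ =>
    realize σ n (subdivision (barycenter n) (n + 1) (Finsupp.single (vertices n) 1))

variable (X) in
/-- The chain homotopy between the identity and barycentric subdivision of singular chains. -/
def singularHomotopy (n : ℕ) : SingularChain X n →ₗ[ℤ] SingularChain X (n + 1) :=
  linExt fun σ => realize σ (n + 1)
    (subdivisionHomotopy (barycenter n) (n + 1) (Finsupp.single (vertices n) 1))

/-- As `σ` is itself the realization of the tuple of vertices, this and `singularHomotopy_realize`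
reduce identities for singular chains to those for tuples. -/
theorem singularSubdivision_realize {n : ℕ} (σ : C(Simplex n, X)) (m : ℕ)
    (c : TupleChain (Simplex n) (m + 1)) :
    singularSubdivision X m (realize σ m c) =
      realize σ m (subdivision (barycenter n) (m + 1) c) := by
  suffices h : singularSubdivision X m ∘ₗ realize σ m =
      realize σ m ∘ₗ subdivision (barycenter n) (m + 1) from LinearMap.congr_fun h c
  refine linearMap_ext_single fun p => ?_
  rw [LinearMap.comp_apply, realize_single, singularSubdivision, linExt_single,
    realize_comp_affineSimplex, mapChain_subdivision _ (affineSimplex_barycenter p),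
    mapChain_single, affineSimplex_comp_vertices, LinearMap.comp_apply]

theorem singularHomotopy_realize {n : ℕ} (σ : C(Simplex n, X)) (m : ℕ)
    (c : TupleChain (Simplex n) (m + 1)) :
    singularHomotopy X m (realize σ m c) =
      realize σ (m + 1) (subdivisionHomotopy (barycenter n) (m + 1) c) := by
  suffices h : singularHomotopy X m ∘ₗ realize σ m =
      realize σ (m + 1) ∘ₗ subdivisionHomotopy (barycenter n) (m + 1) from
    LinearMap.congr_fun h c
  refine linearMap_ext_single fun p => ?_
  rw [LinearMap.comp_apply, realize_single, singularHomotopy, linExt_single,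
    realize_comp_affineSimplex, mapChain_subdivisionHomotopy _ (affineSimplex_barycenter p),
    mapChain_single, affineSimplex_comp_vertices, LinearMap.comp_apply]

theorem singularBoundary_subdivision (n : ℕ) (c : SingularChain X (n + 1)) :
    singularBoundary X n (singularSubdivision X (n + 1) c) =
      singularSubdivision X n (singularBoundary X n c) := by
  suffices h : singularBoundary X n ∘ₗ singularSubdivision X (n + 1) =
      singularSubdivision X n ∘ₗ singularBoundary X n from LinearMap.congr_fun h c
  refine linearMap_ext_single fun σ => ?_
  rw [LinearMap.comp_apply, LinearMap.comp_apply, ← realize_vertices σ,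
    singularSubdivision_realize, singularBoundary_realize, boundary_subdivision,
    singularBoundary_realize, singularSubdivision_realize]

theorem singularBoundary_homotopy (n : ℕ) (c : SingularChain X (n + 1)) :
    singularBoundary X (n + 1) (singularHomotopy X (n + 1) c) =
      c - singularSubdivision X (n + 1) c - singularHomotopy X n (singularBoundary X n c) := by
  suffices h : singularBoundary X (n + 1) ∘ₗ singularHomotopy X (n + 1) = LinearMap.id -
      singularSubdivision X (n + 1) - singularHomotopy X n ∘ₗ singularBoundary X n from
    LinearMap.congr_fun h c
  refine linearMap_ext_single fun σ => ?_
  rw [LinearMap.comp_apply, LinearMap.sub_apply, LinearMap.sub_apply, LinearMap.id_apply,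
    LinearMap.comp_apply, ← realize_vertices σ, singularSubdivision_realize,
    singularHomotopy_realize, singularBoundary_realize, boundary_subdivisionHomotopy,
    singularBoundary_realize, singularHomotopy_realize, map_sub, map_sub]

variable (X) in
/-- The chain homotopy between the identity and the `N`-fold barycentric subdivision. -/
def iteratedHomotopy (n N : ℕ) : SingularChain X n →ₗ[ℤ] SingularChain X (n + 1) :=
  ∑ j ∈ Finset.range N, singularHomotopy X n ∘ₗ singularSubdivision X n ^ j

theorem iteratedHomotopy_apply (n N : ℕ) (c : SingularChain X n) :
    iteratedHomotopy X n N c =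
      ∑ j ∈ Finset.range N, singularHomotopy X n ((singularSubdivision X n ^ j) c) := by
  simp [iteratedHomotopy]

theorem singularBoundary_subdivision_pow (n j : ℕ) (c : SingularChain X (n + 1)) :
    singularBoundary X n ((singularSubdivision X (n + 1) ^ j) c) =
      (singularSubdivision X n ^ j) (singularBoundary X n c) := by
  induction j with
  | zero => simp
  | succ j ih =>
    rw [pow_succ', pow_succ', Module.End.mul_apply, Module.End.mul_apply,
      singularBoundary_subdivision, ih]

/-- Telescoping: apply `∂T + T∂ = 1 - S` to `S^j c` and sum over `j < N`, using that `S` commutes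
with `∂`. -/
theorem singularBoundary_iteratedHomotopy (n N : ℕ) (c : SingularChain X (n + 1)) :
    singularBoundary X (n + 1) (iteratedHomotopy X (n + 1) N c) =
      c - (singularSubdivision X (n + 1) ^ N) c -
        iteratedHomotopy X n N (singularBoundary X n c) := by
  induction N with
  | zero => simp [iteratedHomotopy_apply]
  | succ N ih =>
    rw [iteratedHomotopy_apply, Finset.sum_range_succ, map_add, ← iteratedHomotopy_apply, ih,
      singularBoundary_homotopy, iteratedHomotopy_apply, iteratedHomotopy_apply,
      Finset.sum_range_succ, singularBoundary_subdivision_pow, pow_succ' _ N,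
      Module.End.mul_apply]
    abel

end SimplexSubdivision

end

/-! ### Mesh estimates and small simplices. -/

noncomputable section

namespace SimplexSubdivision

open SingularCochain

theorem linExt_mem {α M : Type*} [AddCommGroup M] {f : α → M} {N : Submodule ℤ M}
    (h : ∀ a, f a ∈ N) (c : α →₀ ℤ) : linExt f c ∈ N := by
  rw [linExt, Finsupp.linearCombination_apply]
  exact N.sum_mem fun a _ => N.smul_mem _ (h a)

theorem map_mem_span_of_forall {M M' : Type*} [AddCommGroup M] [AddCommGroup M']
    (f : M →ₗ[ℤ] M') {s : Set M} {N : Submodule ℤ M'} (h : ∀ x ∈ s, f x ∈ N) {c : M}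
    (hc : c ∈ Submodule.span ℤ s) : f c ∈ N :=
  (Submodule.span_le (p := N.comap f)).2 h hc

/-- The convex hull of the vertices of a tuple. -/
def tupleHull {n k : ℕ} (p : Fin k → Simplex n) : Set (Fin (n + 1) → ℝ) :=
  convexHull ℝ (Set.range fun i => (p i : Fin (n + 1) → ℝ))

theorem coe_affineSimplex_mem_tupleHull {n m : ℕ} (p : Fin (m + 1) → Simplex n) (t : Simplex m) :
    (affineSimplex p t).1 ∈ tupleHull p :=
  (convex_convexHull ℝ _).sum_mem (fun i _ => t.2.1 i) t.2.2
    fun i _ => subset_convexHull ℝ _ ⟨i, rfl⟩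

theorem dist_le_of_mem_tupleHull {n k : ℕ} {p : Fin k → Simplex n} {x y : Simplex n} {d : ℝ}
    (hy : y.1 ∈ tupleHull p) (h : ∀ i, dist (p i) x ≤ d) : dist y x ≤ d := by
  have : tupleHull p ⊆ Metric.closedBall x.1 d := by
    refine convexHull_min ?_ (convex_closedBall _ _)
    rintro _ ⟨i, rfl⟩
    exact h i
  exact this hy

/-- The difference of the barycenter and `p j` is the average of the `k + 1` vectors `p i - p j`,
one of which is zero. -/
theorem dist_barycenter_le {n k : ℕ} {p : Fin (k + 1) → Simplex n} {d : ℝ}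
    (hp : ∀ i j, dist (p i) (p j) ≤ d) (j : Fin (k + 1)) :
    dist (p j) (barycenter n k p) ≤ k / (k + 1) * d := by
  have h1 : (barycenter n k p).1 - (p j).1 = ∑ i, ((k : ℝ) + 1)⁻¹ • ((p i).1 - (p j).1) := by
    funext l
    have h := affineSimplex_apply p stdSimplex.barycenter l
    have hb : ∀ i, (stdSimplex.barycenter : Simplex k) i = ((k : ℝ) + 1)⁻¹ := fun i =>
      (stdSimplex.barycenter_apply i).trans (by simp)
    simp only [hb] at h
    simp only [Finset.sum_apply, Pi.smul_apply, Pi.sub_apply, smul_eq_mul, mul_sub,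
      Finset.sum_sub_distrib, Finset.sum_const, Finset.card_univ, Fintype.card_fin, nsmul_eq_mul]
    refine congrArg₂ (· - ·) h ?_
    push_cast
    field_simp
  have h2 : ∀ i, ‖((k : ℝ) + 1)⁻¹ • ((p i).1 - (p j).1)‖ ≤
      if i = j then 0 else ((k : ℝ) + 1)⁻¹ * d := by
    intro i
    split_ifs with h
    · simp [h]
    · rw [norm_smul, ← dist_eq_norm]
      have : ‖((k : ℝ) + 1)⁻¹‖ = ((k : ℝ) + 1)⁻¹ := by
        rw [Real.norm_of_nonneg]; positivity
      rw [this]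
      exact mul_le_mul_of_nonneg_left (hp i j) (by positivity)
  calc dist (p j) (barycenter n k p) = ‖(barycenter n k p).1 - (p j).1‖ := by
        rw [dist_comm, Subtype.dist_eq, dist_eq_norm]
    _ ≤ ∑ i, if i = j then 0 else ((k : ℝ) + 1)⁻¹ * d := by
        rw [h1]; exact norm_sum_le_of_le _ fun i _ => h2 i
    _ = k / (k + 1) * d := by
        rw [Finset.sum_ite, Finset.sum_const_zero, zero_add, Finset.sum_const,
          Finset.filter_ne' , Finset.card_erase_of_mem (Finset.mem_univ _)]
        simp
        ring

/-- The chains supported on tuples of diameter at most `d` with vertices in `s`. -/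
def fineChain (n k : ℕ) (s : Set (Fin (n + 1) → ℝ)) (d : ℝ) :
    Submodule ℤ (TupleChain (Simplex n) k) :=
  Submodule.span ℤ {c | ∃ q : Fin k → Simplex n, Finsupp.single q 1 = c ∧ (∀ i, (q i).1 ∈ s) ∧
    ∀ i j, dist (q i) (q j) ≤ d}

/-- The hull is carried along for the induction: the subdivided faces have vertices in the hull of
`p`, hence within `r * d` of the new apex. One `r` serves the faces of all dimensions. -/
theorem subdivision_single_mem_fineChain {n : ℕ} {r d : ℝ}
    (k : ℕ) (hr : ∀ m : ℕ, m < k → (m : ℝ) / (m + 1) ≤ r)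
    (p : Fin k → Simplex n) (hp : ∀ i j, dist (p i) (p j) ≤ d) :
    subdivision (barycenter n) k (Finsupp.single p 1) ∈ fineChain n k (tupleHull p) (r * d) := by
  induction k with
  | zero =>
    exact Submodule.subset_span ⟨p, rfl, fun i => i.elim0, fun i => i.elim0⟩
  | succ k ih =>
    have hd : 0 ≤ d := by simpa using hp 0 0
    have hrk := hr k (Nat.lt_succ_self k)
    have hr0 : 0 ≤ r := le_trans (by positivity) hrk
    rw [subdivision_single, boundary_single, map_sum, map_sum]
    refine Submodule.sum_mem _ fun i _ => ?_
    rw [map_zsmul, map_zsmul]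
    refine Submodule.smul_mem _ _ ?_
    refine map_mem_span_of_forall (cone _ k) ?_
      (ih (fun m hm => hr m (hm.trans (Nat.lt_succ_self k))) _ fun a b => hp _ _)
    rintro _ ⟨q, rfl, hq, hqd⟩
    rw [cone_single]
    have hq' : ∀ j, (q j).1 ∈ tupleHull p := fun j =>
      convexHull_mono (by rintro _ ⟨a, rfl⟩; exact ⟨i.succAbove a, rfl⟩) (hq j)
    have hb : ∀ j, dist (q j) (barycenter n k p) ≤ r * d := fun j =>
      dist_le_of_mem_tupleHull (hq' j) fun l => (dist_barycenter_le hp l).trans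
        (mul_le_mul_of_nonneg_right hrk hd)
    refine Submodule.subset_span ⟨_, rfl, fun j => ?_, fun j l => ?_⟩
    · refine Fin.cases ?_ (fun j => ?_) j
      · exact coe_affineSimplex_mem_tupleHull p _
      · simpa using hq' j
    · refine Fin.cases ?_ (fun j => ?_) j <;> refine Fin.cases ?_ (fun l => ?_) l
      · simpa using mul_nonneg hr0 hd
      · simpa [dist_comm] using hb l
      · simpa using hb j
      · simpa using hqd j l

theorem subdivision_mem_fineChain {n : ℕ} {d : ℝ} {c : TupleChain (Simplex n) (n + 1)}
    (hc : c ∈ fineChain n (n + 1) Set.univ d) :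
    subdivision (barycenter n) (n + 1) c ∈ fineChain n (n + 1) Set.univ (n / (n + 1) * d) := by
  refine map_mem_span_of_forall _ ?_ hc
  rintro _ ⟨q, rfl, -, hq⟩
  refine Submodule.span_mono ?_ (subdivision_single_mem_fineChain (r := n / (n + 1)) _ ?_ q hq)
  · rintro _ ⟨q', rfl, -, h⟩
    exact ⟨q', rfl, fun _ => trivial, h⟩
  · intro m hm
    have : (m : ℝ) ≤ n := by exact_mod_cast Nat.lt_succ_iff.1 hm
    rw [div_le_div_iff₀ (by positivity) (by positivity)]
    nlinarith

theorem subdivision_pow_vertices_mem_fineChain (n N : ℕ) :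
    (subdivision (barycenter n) (n + 1) ^ N) (Finsupp.single (vertices n) 1) ∈
      fineChain n (n + 1) Set.univ ((n / (n + 1) : ℝ) ^ N) := by
  induction N with
  | zero =>
    refine Submodule.subset_span ⟨_, rfl, fun _ => trivial, fun i j => ?_⟩
    rw [pow_zero]
    -- In the sup metric the standard simplex has diameter at most 1, so the bound carries no
    -- constant.
    exact (Metric.dist_le_diam_of_mem (bounded_stdSimplex _) (vertices n i).2
      (vertices n j).2).trans diam_stdSimplex_le
  | succ N ih =>
    rw [pow_succ', pow_succ', Module.End.mul_apply]
    exact subdivision_mem_fineChain ih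

variable {X : Type*} [TopologicalSpace X]

/-- A subset is small with respect to a family of sets if it is contained in one of them. -/
def IsSmall {X : Type*} (𝒰 : Set (Set X)) (s : Set X) : Prop := ∃ U ∈ 𝒰, s ⊆ U

theorem IsSmall.mono {X : Type*} {𝒰 : Set (Set X)} {s t : Set X} (ht : IsSmall 𝒰 t)
    (h : s ⊆ t) : IsSmall 𝒰 s :=
  ht.imp fun _ hU => ⟨hU.1, h.trans hU.2⟩

/-- The singular chains supported on small simplices. -/
def smallChain (𝒰 : Set (Set X)) (n : ℕ) : Submodule ℤ (SingularChain X n) :=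
  Submodule.span ℤ {c | ∃ σ : C(Simplex n, X), Finsupp.single σ 1 = c ∧ IsSmall 𝒰 (Set.range σ)}

theorem realize_mem_smallChain {𝒰 : Set (Set X)} {n : ℕ} {σ : C(Simplex n, X)}
    (h : IsSmall 𝒰 (Set.range σ)) (m : ℕ) (c : TupleChain (Simplex n) (m + 1)) :
    realize σ m c ∈ smallChain 𝒰 m :=
  linExt_mem (N := smallChain 𝒰 m) (fun p => Submodule.subset_span
    ⟨σ.comp (affineSimplex p), rfl, h.mono (Set.range_comp_subset_range _ σ)⟩) c

theorem singularSubdivision_mem_smallChain {𝒰 : Set (Set X)} {n : ℕ} {c : SingularChain X n}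
    (hc : c ∈ smallChain 𝒰 n) : singularSubdivision X n c ∈ smallChain 𝒰 n := by
  refine map_mem_span_of_forall _ ?_ hc
  rintro _ ⟨σ, rfl, hσ⟩
  rw [singularSubdivision, linExt_single]
  exact realize_mem_smallChain hσ _ _

theorem singularHomotopy_mem_smallChain {𝒰 : Set (Set X)} {n : ℕ} {c : SingularChain X n}
    (hc : c ∈ smallChain 𝒰 n) : singularHomotopy X n c ∈ smallChain 𝒰 (n + 1) := by
  refine map_mem_span_of_forall _ ?_ hc
  rintro _ ⟨σ, rfl, hσ⟩
  rw [singularHomotopy, linExt_single]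
  exact realize_mem_smallChain hσ _ _

theorem singularSubdivision_pow_mem_smallChain {𝒰 : Set (Set X)} {n : ℕ} {c : SingularChain X n}
    {N M : ℕ} (hc : (singularSubdivision X n ^ N) c ∈ smallChain 𝒰 n) (h : N ≤ M) :
    (singularSubdivision X n ^ M) c ∈ smallChain 𝒰 n := by
  induction M, h using Nat.le_induction with
  | base => exact hc
  | succ M _ ih =>
    rw [pow_succ', Module.End.mul_apply]
    exact singularSubdivision_mem_smallChain ih

theorem singularSubdivision_pow_realize {n : ℕ} (σ : C(Simplex n, X)) (m N : ℕ)
    (c : TupleChain (Simplex n) (m + 1)) :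
    (singularSubdivision X m ^ N) (realize σ m c) =
      realize σ m ((subdivision (barycenter n) (m + 1) ^ N) c) := by
  induction N with
  | zero => simp
  | succ N ih =>
    rw [pow_succ', pow_succ', Module.End.mul_apply, Module.End.mul_apply, ih,
      singularSubdivision_realize]

/-- The mesh eventually drops below a Lebesgue number of the pulled-back cover. The exponent depends
on `σ`. -/
theorem exists_singularSubdivision_pow_mem_smallChain {𝒰 : Set (Set X)}
    (ho : ∀ U ∈ 𝒰, IsOpen U) (hc : ⋃₀ 𝒰 = Set.univ) {n : ℕ} (σ : C(Simplex n, X)) :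
    ∃ N : ℕ, (singularSubdivision X n ^ N) (Finsupp.single σ 1) ∈ smallChain 𝒰 n := by
  have : CompactSpace (Simplex n) := isCompact_iff_compactSpace.1 (isCompact_stdSimplex _ _)
  obtain ⟨δ, hδ, hδ'⟩ := lebesgue_number_lemma_of_metric (c := fun U : 𝒰 => σ ⁻¹' U.1)
    (isCompact_univ (X := Simplex n)) (fun U => (ho U.1 U.2).preimage σ.continuous) (by
      intro x _
      obtain ⟨U, hU, hx⟩ := (hc.symm ▸ Set.mem_univ (σ x) : σ x ∈ ⋃₀ 𝒰)
      exact Set.mem_iUnion.2 ⟨⟨U, hU⟩, hx⟩)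
  obtain ⟨N, hN⟩ := exists_pow_lt_of_lt_one hδ (y := (n / (n + 1) : ℝ))
    (by rw [div_lt_one (by positivity)]; linarith)
  refine ⟨N, ?_⟩
  rw [← realize_vertices σ, singularSubdivision_pow_realize]
  refine map_mem_span_of_forall _ ?_ (subdivision_pow_vertices_mem_fineChain n N)
  rintro _ ⟨q, rfl, -, hq⟩
  rw [realize_single]
  obtain ⟨U, hU⟩ := hδ' (q 0) (Set.mem_univ _)
  refine Submodule.subset_span ⟨_, rfl, U.1, U.2, ?_⟩
  rintro _ ⟨t, rfl⟩
  exact hU ((dist_le_of_mem_tupleHull (coe_affineSimplex_mem_tupleHull q t)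
    fun i => hq i 0).trans_lt hN)

end SimplexSubdivision

end

/-! ### Cochains vanishing on small simplices. -/

noncomputable section

namespace SingularCochain

open CategoryTheory Opposite SimplexSubdivision

section Subcomplex

variable {ι : Type*} {c : ComplexShape ι} (K : HomologicalComplex AddCommGrpCat.{u} c)
  (S : ∀ i, AddSubgroup (K.X i)) (hS : ∀ i j, ∀ x ∈ S i, K.d i j x ∈ S j)

/-- The subcomplex given by a family of subgroups stable under the differential. -/
def subcomplex : HomologicalComplex AddCommGrpCat.{u} c where
  X i := AddCommGrpCat.of (S i)
  d i j := AddCommGrpCat.ofHom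
    (((K.d i j).hom.comp (S i).subtype).codRestrict (S j) fun x => hS i j x x.2)
  shape i j hij := by
    ext x
    change K.d i j x.1 = 0
    rw [K.shape i j hij]
    rfl
  d_comp_d' i j k _ _ := by
    ext x
    exact ConcreteCategory.congr_hom (K.d_comp_d i j k) (x.1 : K.X i)

end Subcomplex

variable {X Y Z : TopCat.{u}}

/-- The cochains which vanish on all small simplices. -/
def vanishing (X : TopCat.{u}) (𝒰 : Set (Set X)) (n : ℕ) :
    AddSubgroup ((cochainFunctor.obj (op X)).X n) where
  carrier := {φ | ∀ σ : C(Simplex n, X), IsSmall 𝒰 (Set.range σ) → ev X n φ σ = 0}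
  zero_mem' σ _ := by simp
  add_mem' {φ ψ} hφ hψ σ hσ := by simp [hφ σ hσ, hψ σ hσ]
  neg_mem' {φ} hφ σ hσ := by simp [hφ σ hσ]

theorem d_mem_vanishing (𝒰 : Set (Set X)) (i j : ℕ) (φ : (cochainFunctor.obj (op X)).X i)
    (hφ : φ ∈ vanishing X 𝒰 i) : (cochainFunctor.obj (op X)).d i j φ ∈ vanishing X 𝒰 j := by
  by_cases hij : (ComplexShape.down ℕ).symm.Rel i j
  · obtain rfl : i + 1 = j := hij
    intro σ hσ
    rw [ev_d]
    refine Finset.sum_eq_zero fun k _ => ?_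
    rw [hφ _ (hσ.mono (Set.range_comp_subset_range _ σ)), smul_zero]
  · rw [(cochainFunctor.obj (op X)).shape i j hij]
    exact (vanishing X 𝒰 j).zero_mem

/-- The complex of cochains vanishing on all small simplices. For a family consisting of one set
this is the complex of relative cochains. -/
def relCochain (X : TopCat.{u}) (𝒰 : Set (Set X)) :
    HomologicalComplex AddCommGrpCat.{u} (ComplexShape.down ℕ).symm :=
  subcomplex (cochainFunctor.obj (op X)) (vanishing X 𝒰) (d_mem_vanishing 𝒰)

/-- A map carrying nonempty small sets to small sets. -/
def MapsSmall (f : X ⟶ Y) (𝒰 : Set (Set X)) (𝒱 : Set (Set Y)) : Prop :=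
  ∀ s, s.Nonempty → IsSmall 𝒰 s → IsSmall 𝒱 (f '' s)

theorem map_mem_vanishing {f : X ⟶ Y} {𝒰 : Set (Set X)} {𝒱 : Set (Set Y)}
    (hf : MapsSmall f 𝒰 𝒱) {n : ℕ} {φ : (cochainFunctor.obj (op Y)).X n}
    (hφ : φ ∈ vanishing Y 𝒱 n) : (cochainFunctor.map f.op).f n φ ∈ vanishing X 𝒰 n := by
  intro σ hσ
  rw [ev_map]
  refine hφ _ ?_
  have := hf _ (Set.range_nonempty σ) hσ
  rwa [← Set.range_comp] at this

/-- Functoriality of the complex of cochains vanishing on small simplices. -/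
def relMap (f : X ⟶ Y) {𝒰 : Set (Set X)} {𝒱 : Set (Set Y)} (hf : MapsSmall f 𝒰 𝒱) :
    relCochain Y 𝒱 ⟶ relCochain X 𝒰 where
  f n := AddCommGrpCat.ofHom ((((cochainFunctor.map f.op).f n).hom.comp
    (vanishing Y 𝒱 n).subtype).codRestrict (vanishing X 𝒰 n) fun x => map_mem_vanishing hf x.2)
  comm' i j _ := by
    ext x
    apply Subtype.ext
    exact ConcreteCategory.congr_hom ((cochainFunctor.map f.op).comm i j)
      (x.1 : (cochainFunctor.obj (op Y)).X i)

theorem ev_relMap (f : X ⟶ Y) {𝒰 : Set (Set X)} {𝒱 : Set (Set Y)} (hf : MapsSmall f 𝒰 𝒱) (n : ℕ)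
    (φ : vanishing Y 𝒱 n) (σ : C(Simplex n, X)) :
    ev X n ((relMap f hf).f n φ : vanishing X 𝒰 n).1 σ = ev Y n φ.1 (f.hom.comp σ) :=
  ev_map f n φ.1 σ

theorem relMap_comp (f : X ⟶ Y) (g : Y ⟶ Z) {𝒰 : Set (Set X)} {𝒱 : Set (Set Y)}
    {𝒲 : Set (Set Z)} (hf : MapsSmall f 𝒰 𝒱) (hg : MapsSmall g 𝒱 𝒲)
    (hfg : MapsSmall (f ≫ g) 𝒰 𝒲) :
    relMap (f ≫ g) hfg = relMap g hg ≫ relMap f hf := by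
  ext n φ
  apply Subtype.ext
  apply (ev X n).injective
  funext σ
  exact (ev_relMap (f ≫ g) hfg n φ σ).trans
    ((ev_relMap f hf n _ σ).trans (ev_relMap g hg n _ _)).symm

theorem relMap_id {𝒰 : Set (Set X)} (h : MapsSmall (𝟙 X) 𝒰 𝒰) :
    relMap (𝟙 X) h = 𝟙 _ := by
  ext n φ
  apply Subtype.ext
  apply (ev X n).injective
  funext σ
  exact ev_relMap (𝟙 X) h n φ σ

/-- Families with the same small sets yield isomorphic complexes, and so do homeomorphic spaces. -/
def relIso (e : X ≅ Y) {𝒰 : Set (Set X)} {𝒱 : Set (Set Y)} (h : MapsSmall e.hom 𝒰 𝒱)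
    (h' : MapsSmall e.inv 𝒱 𝒰) : relCochain Y 𝒱 ≅ relCochain X 𝒰 where
  hom := relMap e.hom h
  inv := relMap e.inv h'
  hom_inv_id := by
    have h2 : MapsSmall (e.inv ≫ e.hom) 𝒱 𝒱 := fun s _ hs => by simpa using hs
    rw [← relMap_comp _ _ _ _ h2]
    simp only [e.inv_hom_id, relMap_id]
  inv_hom_id := by
    have h2 : MapsSmall (e.hom ≫ e.inv) 𝒰 𝒰 := fun s _ hs => by simpa using hs
    rw [← relMap_comp _ _ _ _ h2]
    simp only [e.hom_inv_id, relMap_id]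

theorem not_isSmall_empty {α : Type*} (s : Set α) : ¬ IsSmall ∅ s := fun ⟨_, h, _⟩ => h

theorem mapsSmall_empty (f : X ⟶ Y) (𝒱 : Set (Set Y)) : MapsSmall f ∅ 𝒱 :=
  fun _ _ hs => (not_isSmall_empty _ hs).elim

/-- All cochains vanish on the empty family. -/
def relCochainEmptyIso (X : TopCat.{u}) : relCochain X ∅ ≅ cochainFunctor.obj (op X) :=
  HomologicalComplex.Hom.isoOfComponents
    (fun n => AddEquiv.toAddCommGrpIso (X := AddCommGrpCat.of (vanishing X ∅ n))
      (Y := (cochainFunctor.obj (op X)).X n)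
      ⟨⟨Subtype.val, fun φ => ⟨φ, fun _ h => (not_isSmall_empty _ h).elim⟩, fun _ => rfl,
        fun _ => rfl⟩, fun _ _ => rfl⟩)
    (fun i j _ => by ext; rfl)

theorem relCochainEmptyIso_naturality (f : X ⟶ Y) :
    relMap f (mapsSmall_empty f ∅) ≫ (relCochainEmptyIso X).hom =
      (relCochainEmptyIso Y).hom ≫ cochainFunctor.map f.op := by
  ext n φ
  rfl

section ShortExact

theorem mapsSmall_id {𝒰 𝒱 : Set (Set X)}
    (h : ∀ s, s.Nonempty → IsSmall 𝒰 s → IsSmall 𝒱 s) : MapsSmall (𝟙 X) 𝒰 𝒱 :=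
  fun s hn hs => by simpa using h s hn hs

theorem mapsSmall_of_iff {j : Y ⟶ X} {𝒰 : Set (Set X)} {𝒲 : Set (Set Y)}
    (h𝒲 : ∀ s, IsSmall 𝒲 s ↔ IsSmall 𝒰 (j '' s)) : MapsSmall j 𝒲 𝒰 :=
  fun s _ hs => (h𝒲 s).1 hs

/-- The restriction sequence attached to an embedding `j : Y ⟶ X` and a family `𝒰` on `X`; here
`𝒱` generates the same small sets as `𝒰` together with the image of `j`. -/
def restrictionSequence (j : Y ⟶ X) {𝒱 𝒰 : Set (Set X)} {𝒲 : Set (Set Y)}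
    (h𝒱 : ∀ s, IsSmall 𝒱 s ↔ IsSmall 𝒰 s ∨ s ⊆ Set.range j)
    (h𝒲 : ∀ s, IsSmall 𝒲 s ↔ IsSmall 𝒰 (j '' s)) :
    ShortComplex (HomologicalComplex AddCommGrpCat.{u} (ComplexShape.down ℕ).symm) where
  X₁ := relCochain X 𝒱
  X₂ := relCochain X 𝒰
  X₃ := relCochain Y 𝒲
  f := relMap (𝟙 X) (mapsSmall_id fun s _ hs => (h𝒱 s).2 (Or.inl hs))
  g := relMap j (mapsSmall_of_iff h𝒲)
  zero := by
    ext n φ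
    apply Subtype.ext
    apply (ev Y n).injective
    funext σ
    refine (ev_relMap j (mapsSmall_of_iff h𝒲) n _ σ).trans ((ev_relMap (𝟙 X)
      (mapsSmall_id fun s _ hs => (h𝒱 s).2 (Or.inl hs)) n φ _).trans ?_)
    refine (φ.2 _ ?_).trans (congrFun (map_zero (ev Y n)) σ).symm
    refine (h𝒱 _).2 (Or.inr ?_)
    rintro _ ⟨t, rfl⟩
    exact ⟨σ t, rfl⟩

theorem restrictionSequence_shortExact (j : Y ⟶ X) {𝒱 𝒰 : Set (Set X)} {𝒲 : Set (Set Y)}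
    (h𝒱 : ∀ s, IsSmall 𝒱 s ↔ IsSmall 𝒰 s ∨ s ⊆ Set.range j)
    (h𝒲 : ∀ s, IsSmall 𝒲 s ↔ IsSmall 𝒰 (j '' s)) (hj : Topology.IsEmbedding j) :
    (restrictionSequence j h𝒱 h𝒲).ShortExact := by
  classical
  have hid : MapsSmall (𝟙 X) 𝒰 𝒱 := mapsSmall_id fun s _ hs => (h𝒱 s).2 (Or.inl hs)
  have hj' : MapsSmall j 𝒲 𝒰 := mapsSmall_of_iff h𝒲
  refine HomologicalComplex.shortExact_of_degreewise_shortExact _ fun n => ?_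
  have hmono : Mono ((restrictionSequence j h𝒱 h𝒲).map (HomologicalComplex.eval _ _ n)).f := by
    rw [AddCommGrpCat.mono_iff_injective]
    intro φ ψ h
    apply Subtype.ext
    apply (ev X n).injective
    funext σ
    have := congrArg (fun θ : vanishing X 𝒰 n => ev X n θ.1 σ) h
    exact ((ev_relMap (𝟙 X) hid n φ σ).symm.trans this).trans (ev_relMap (𝟙 X) hid n ψ σ)
  have hepi : Epi ((restrictionSequence j h𝒱 h𝒲).map (HomologicalComplex.eval _ _ n)).g := by
    rw [AddCommGrpCat.epi_iff_surjective]
    intro ψ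
    -- Extension by zero to the simplices that do not factor through `j`.
    let F : C(Simplex n, X) → ULift.{u} ℤ := fun σ =>
      if h : ∃ τ : C(Simplex n, Y), j.hom.comp τ = σ then ev Y n ψ.1 h.choose else 0
    have hF : (ev X n).symm F ∈ vanishing X 𝒰 n := by
      intro σ hσ
      rw [AddEquiv.apply_symm_apply]
      by_cases h : ∃ τ : C(Simplex n, Y), j.hom.comp τ = σ
      · simp only [F, dif_pos h]
        refine ψ.2 _ ((h𝒲 _).2 ?_)
        rw [← Set.range_comp]
        rwa [← h.choose_spec] at hσ
      · simp only [F, dif_neg h]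
    refine ⟨⟨(ev X n).symm F, hF⟩, ?_⟩
    apply Subtype.ext
    apply (ev Y n).injective
    funext τ
    refine (ev_relMap j hj' n _ τ).trans ?_
    rw [AddEquiv.apply_symm_apply]
    have h : ∃ τ' : C(Simplex n, Y), j.hom.comp τ' = j.hom.comp τ := ⟨τ, rfl⟩
    simp only [F, dif_pos h]
    exact congrArg (ev Y n ψ.1) (ContinuousMap.ext fun t =>
      hj.injective (DFunLike.congr_fun h.choose_spec t))
  refine ⟨?_⟩
  rw [ShortComplex.ab_exact_iff]
  intro φ hφ
  -- A `𝒱`-small simplex is `𝒰`-small or lifts through the embedding `j`, and `φ` restricts to zero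
  -- along `j`.
  have hφ' : φ.1 ∈ vanishing X 𝒱 n := by
    intro σ hσ
    rcases (h𝒱 _).1 hσ with h | h
    · exact φ.2 σ h
    · have hτ : ∀ t, ∃ y, j y = σ t := fun t => h ⟨t, rfl⟩
      choose τ hτ using hτ
      have hc : Continuous τ := by
        rw [hj.continuous_iff]
        exact σ.continuous.congr fun t => (hτ t).symm
      have := congrArg (fun θ : vanishing Y 𝒲 n => ev Y n θ.1 ⟨τ, hc⟩) hφ
      have h2 := ((ev_relMap j hj' n φ ⟨τ, hc⟩).symm.trans this)
      have h3 : j.hom.comp ⟨τ, hc⟩ = σ := ContinuousMap.ext hτ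
      rw [h3] at h2
      exact h2.trans (congrFun (map_zero (ev Y n)) _)
  refine ⟨⟨φ.1, hφ'⟩, ?_⟩
  apply Subtype.ext
  apply (ev X n).injective
  funext σ
  exact ev_relMap (𝟙 X) hid n ⟨φ.1, hφ'⟩ σ

end ShortExact

section Acyclic

/-- The evaluation of a cochain on a chain. -/
def pairing {n : ℕ} (φ : (cochainFunctor.obj (op X)).X n) : SingularChain X n →ₗ[ℤ] ULift.{u} ℤ :=
  linExt (ev X n φ)

theorem pairing_d {n : ℕ} (φ : (cochainFunctor.obj (op X)).X n) (c : SingularChain X (n + 1)) :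
    pairing ((cochainFunctor.obj (op X)).d n (n + 1) φ) c =
      pairing φ (singularBoundary X n c) := by
  suffices h : pairing ((cochainFunctor.obj (op X)).d n (n + 1) φ) =
      pairing φ ∘ₗ singularBoundary X n from LinearMap.congr_fun h c
  refine linearMap_ext_single fun σ => ?_
  rw [LinearMap.comp_apply, singularBoundary_single, pairing, linExt_single, ev_d, map_sum]
  simp only [map_zsmul, pairing, linExt_single]

theorem pairing_eq_zero {𝒰 : Set (Set X)} {n : ℕ} {φ : (cochainFunctor.obj (op X)).X n}
    (hφ : φ ∈ vanishing X 𝒰 n) {c : SingularChain X n} (hc : c ∈ smallChain 𝒰 n) :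
    pairing φ c = 0 := by
  have := map_mem_span_of_forall (N := ⊥) (pairing φ) ?_ hc
  · simpa using this
  · rintro _ ⟨σ, rfl, hσ⟩
    rw [pairing, linExt_single]
    simpa using hφ σ hσ

/-- The additional terms `T S^j c` with `j ≥ M` are small chains, on which `φ` vanishes. -/
theorem pairing_iteratedHomotopy_eq {𝒰 : Set (Set X)} {n : ℕ}
    {φ : (cochainFunctor.obj (op X)).X (n + 1)} (hφ : φ ∈ vanishing X 𝒰 (n + 1))
    {c : SingularChain X n} {M N : ℕ} (hMN : M ≤ N)
    (hc : (singularSubdivision X n ^ M) c ∈ smallChain 𝒰 n) :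
    pairing φ (iteratedHomotopy X n N c) = pairing φ (iteratedHomotopy X n M c) := by
  rw [iteratedHomotopy_apply, iteratedHomotopy_apply, map_sum, map_sum]
  refine (Finset.sum_subset (Finset.range_mono hMN) fun j _ hj => ?_).symm
  refine pairing_eq_zero hφ (singularHomotopy_mem_smallChain
    (singularSubdivision_pow_mem_smallChain hc ?_))
  simpa using hj

/-- No single number of subdivisions makes all simplices small. So a cocycle `φ` gets the primitive
`ψ(τ) = φ(D_{m(τ)} τ)`, where `D_N` is the iterated homotopy and `m(τ)` the least number of
subdivisions making `τ` small. -/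
theorem relCochain_acyclic {𝒰 : Set (Set X)} (ho : ∀ U ∈ 𝒰, IsOpen U)
    (hc : ⋃₀ 𝒰 = Set.univ) : (relCochain X 𝒰).Acyclic := by
  classical
  intro n
  cases n with
  | zero =>
    rw [HomologicalComplex.exactAt_iff, ShortComplex.ab_exact_iff]
    intro φ _
    -- In degree 0 already `φ = 0`, because every point lies in a member of the cover.
    refine ⟨0, ?_⟩
    rw [map_zero]
    symm
    apply Subtype.ext
    apply (ev X 0).injective
    funext σ
    refine (φ.2 σ ?_).trans (congrFun (map_zero (ev X 0)) σ).symm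
    obtain ⟨U, hU, hx⟩ := (hc.symm ▸ Set.mem_univ (σ default) : σ default ∈ ⋃₀ 𝒰)
    refine ⟨U, hU, ?_⟩
    rintro _ ⟨t, rfl⟩
    rwa [Subsingleton.elim t default]
  | succ n =>
    have hprev : (ComplexShape.down ℕ).symm.prev (n + 1) = n := ComplexShape.prev_eq' _ rfl
    have hnext : (ComplexShape.down ℕ).symm.next (n + 1) = n + 2 := ComplexShape.next_eq' _ rfl
    rw [HomologicalComplex.exactAt_iff' _ n (n + 1) (n + 2) hprev hnext,
      ShortComplex.ab_exact_iff]
    intro φ hφ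
    have hdφ : (cochainFunctor.obj (op X)).d (n + 1) (n + 2) φ.1 = 0 :=
      congrArg (fun θ : vanishing X 𝒰 (n + 2) => θ.1) hφ
    have hex := fun τ : C(Simplex n, X) => exists_singularSubdivision_pow_mem_smallChain ho hc τ
    let m : C(Simplex n, X) → ℕ := fun τ => Nat.find (hex τ)
    let ψ : (cochainFunctor.obj (op X)).X n := (ev X n).symm fun τ =>
      pairing φ.1 (iteratedHomotopy X n (m τ) (Finsupp.single τ 1))
    -- A small simplex needs no subdivision, and `D_0 = 0`.
    have hψ : ψ ∈ vanishing X 𝒰 n := by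
      intro τ hτ
      have hm : m τ = 0 := by
        simp only [m, Nat.find_eq_zero]
        exact Submodule.subset_span ⟨τ, rfl, hτ⟩
      simp only [ψ, AddEquiv.apply_symm_apply, hm]
      simp [iteratedHomotopy_apply]
    refine ⟨⟨ψ, hψ⟩, ?_⟩
    apply Subtype.ext
    apply (ev X (n + 1)).injective
    funext σ
    refine (ev_d X n ψ σ).trans ?_
    obtain ⟨N₀, hN₀⟩ := exists_singularSubdivision_pow_mem_smallChain ho hc σ
    -- This `N` is large enough for `σ` and all its faces. Then `dψ(σ) = φ(D_N ∂σ) = φ(σ - S^N σ - ∂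
    -- D_N σ) = φ(σ)`, since `S^N σ` is small and `dφ = 0`.
    let N := N₀ + ∑ i : Fin (n + 2), m (σ.comp (faceMap i))
    have hN : ∀ i : Fin (n + 2), m (σ.comp (faceMap i)) ≤ N := fun i =>
      (Finset.single_le_sum (f := fun i => m (σ.comp (faceMap i))) (fun _ _ => Nat.zero_le _)
        (Finset.mem_univ i)).trans (Nat.le_add_left _ _)
    have h1 : ∀ i : Fin (n + 2), ev X n ψ (σ.comp (faceMap i)) =
        pairing φ.1 (iteratedHomotopy X n N (Finsupp.single (σ.comp (faceMap i)) 1)) := fun i => by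
      simp only [ψ, AddEquiv.apply_symm_apply]
      exact (pairing_iteratedHomotopy_eq φ.2 (hN i) (Nat.find_spec (hex _))).symm
    simp only [h1, ← map_zsmul]
    rw [← map_sum, ← map_sum, ← singularBoundary_single]
    have h2 := singularBoundary_iteratedHomotopy n N (Finsupp.single σ 1)
    have h3 : iteratedHomotopy X n N (singularBoundary X n (Finsupp.single σ 1)) =
        Finsupp.single σ 1 - (singularSubdivision X (n + 1) ^ N) (Finsupp.single σ 1) -
        singularBoundary X (n + 1) (iteratedHomotopy X (n + 1) N (Finsupp.single σ 1)) := by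
      rw [h2]; abel
    rw [h3, map_sub, map_sub, ← pairing_d, hdφ, pairing_eq_zero φ.2
      (singularSubdivision_pow_mem_smallChain hN₀ (Nat.le_add_right _ _)), pairing, linExt_single]
    simp [pairing]

end Acyclic

end SingularCochain

end

/-! ### Quasi-isomorphisms and short exact sequences of complexes. -/

noncomputable section

namespace HomologicalComplex.HomologySequence

open CategoryTheory

variable {C ι : Type*} [Category* C] [Abelian C] {c : ComplexShape ι}
  {S₁ S₂ : ShortComplex (HomologicalComplex C c)}

/-- A morphism of short exact sequences of complexes which is a quasi-isomorphism on the middle and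
right terms is a quasi-isomorphism on the left terms. -/
theorem quasiIso_τ₁ (φ : S₁ ⟶ S₂) (hS₁ : S₁.ShortExact) (hS₂ : S₂.ShortExact)
    (h₂ : QuasiIso φ.τ₂) (h₃ : QuasiIso φ.τ₃) : QuasiIso φ.τ₁ := by
  rw [quasiIso_iff]
  intro j
  rw [quasiIsoAt_iff_isIso_homologyMap]
  by_cases hj : ∃ i, c.Rel i j
  · obtain ⟨i, hij⟩ := hj
    -- The five lemma, applied to the six-term sequence without its first term.
    refine Abelian.isIso_of_epi_of_isIso_of_isIso_of_mono
      (composableArrows₅_exact hS₁ i j hij).δ₀ (composableArrows₅_exact hS₂ i j hij).δ₀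
      (ComposableArrows.δ₀Functor.map (mapComposableArrows₅ φ hS₁ hS₂ i j hij)) ?_ ?_ ?_ ?_
    · exact inferInstanceAs (Epi (homologyMap φ.τ₂ i))
    · exact inferInstanceAs (IsIso (homologyMap φ.τ₃ i))
    · exact inferInstanceAs (IsIso (homologyMap φ.τ₂ j))
    · exact inferInstanceAs (Mono (homologyMap φ.τ₃ j))
  -- Nothing precedes degree `j`, so the homology of `X₁` in degree `j` is the kernel of the map
  -- from that of `X₂` to that of `X₃`.
  · push Not at hj
    have := hS₁.mono_f
    have := hS₂.mono_f
    have m₁ := mono_homologyMap_of_mono_of_not_rel S₁.f j hj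
    have m₂ := mono_homologyMap_of_mono_of_not_rel S₂.f j hj
    have w : homologyMap φ.τ₁ j ≫ homologyMap S₂.f j =
        homologyMap S₁.f j ≫ homologyMap φ.τ₂ j := by
      rw [← homologyMap_comp, ← homologyMap_comp, φ.comm₁₂]
    have w' : homologyMap φ.τ₂ j ≫ homologyMap S₂.g j =
        homologyMap S₁.g j ≫ homologyMap φ.τ₃ j := by
      rw [← homologyMap_comp, ← homologyMap_comp, φ.comm₂₃]
    have : Mono (homologyMap φ.τ₁ j) := by
      have : Mono (homologyMap φ.τ₁ j ≫ homologyMap S₂.f j) := by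
        rw [w]; infer_instance
      exact mono_of_mono _ (homologyMap S₂.f j)
    have hker := (hS₁.homology_exact₂ j)
    let l : S₂.X₁.homology j ⟶ S₁.X₁.homology j :=
      hker.lift (homologyMap S₂.f j ≫ inv (homologyMap φ.τ₂ j)) (by
        rw [← cancel_mono (homologyMap φ.τ₃ j)]
        dsimp
        rw [Category.assoc, Category.assoc, ← w', IsIso.inv_hom_id_assoc, Limits.zero_comp,
          ← homologyMap_comp, S₂.zero, homologyMap_zero])
    have hl : l ≫ homologyMap S₁.f j = homologyMap S₂.f j ≫ inv (homologyMap φ.τ₂ j) :=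
      hker.lift_f _ _
    have hl' : l ≫ homologyMap φ.τ₁ j = 𝟙 _ := by
      rw [← cancel_mono (homologyMap S₂.f j), Category.assoc, w, ← Category.assoc, hl,
        Category.assoc, IsIso.inv_hom_id, Category.comp_id, Category.id_comp]
    have : IsSplitEpi (homologyMap φ.τ₁ j) := ⟨⟨⟨l, hl'⟩⟩⟩
    exact isIso_of_mono_of_isSplitEpi _

/-- If the left term of a short exact sequence of complexes is acyclic, then the epimorphism is a
quasi-isomorphism. -/
theorem quasiIso_g_of_acyclic (hS₁ : S₁.ShortExact) (h : S₁.X₁.Acyclic) : QuasiIso S₁.g := by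
  rw [quasiIso_iff]
  intro i
  rw [quasiIsoAt_iff_isIso_homologyMap]
  have h0 : ∀ i, Limits.IsZero (S₁.X₁.homology i) := fun i => (h i).isZero_homology
  have : Mono (homologyMap S₁.g i) := (hS₁.homology_exact₂ i).mono_g ((h0 i).eq_of_src _ _)
  have : Epi (homologyMap S₁.g i) := by
    by_cases hi : ∃ j, c.Rel i j
    · obtain ⟨j, hij⟩ := hi
      exact (hS₁.homology_exact₃ i j hij).epi_f ((h0 j).eq_of_tgt _ _)
    · push Not at hi
      have := hS₁.epi_g
      exact epi_homologyMap_of_epi_of_not_rel S₁.g i hi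
  exact isIso_of_mono_of_epi _

theorem isZero_homology_X₁ (hS₁ : S₁.ShortExact) (j : ι) (hj : ∀ i, ¬ c.Rel i j)
    (h : Limits.IsZero (S₁.X₂.homology j)) : Limits.IsZero (S₁.X₁.homology j) := by
  have := hS₁.mono_f
  have := mono_homologyMap_of_mono_of_not_rel S₁.f j hj
  exact Limits.IsZero.of_mono (homologyMap S₁.f j) h

end HomologicalComplex.HomologySequence

/-! ### Excision, pairs, and the cohomology of a point. -/

namespace SingularCochain

open CategoryTheory Opposite SimplexSubdivision

variable {X Y : TopCat.{u}}

theorem isSmall_singleton {α : Type*} {U s : Set α} : IsSmall {U} s ↔ s ⊆ U := by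
  simp [IsSmall]

theorem isSmall_pair {α : Type*} {U V s : Set α} : IsSmall {U, V} s ↔ s ⊆ U ∨ s ⊆ V := by
  simp [IsSmall]

theorem mapsSmall_singleton {f : X ⟶ Y} {U : Set X} {V : Set Y} (h : Set.MapsTo f U V) :
    MapsSmall f {U} {V} := fun s _ hs => by
  rw [isSmall_singleton] at hs ⊢
  exact (Set.image_mono hs).trans h.image_subset

theorem nonempty_homologyIso {K L : HomologicalComplex AddCommGrpCat.{u} (ComplexShape.down ℕ).symm}
    {f : K ⟶ L} (_ : QuasiIso f) (n : ℕ) : Nonempty (K.homology n ≅ L.homology n) :=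
  ⟨isoOfQuasiIsoAt f n⟩

/-- Excision. -/
theorem quasiIso_relMap_of_isOpenEmbedding (j : Y ⟶ X) (hj : Topology.IsOpenEmbedding j)
    {U : Set X} (hU : IsOpen U) {W : Set Y} (hW : W = j ⁻¹' U) (h : U ∪ Set.range j = Set.univ) :
    QuasiIso (relMap j (𝒰 := {W}) (𝒱 := {U})
      (mapsSmall_singleton (by rw [hW]; exact Set.mapsTo_preimage _ _))) := by
  have hS := restrictionSequence_shortExact j (𝒱 := {U, Set.range j}) (𝒰 := {U}) (𝒲 := {W})
    (fun s => by rw [isSmall_pair, isSmall_singleton])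
    (fun s => by rw [isSmall_singleton, isSmall_singleton, hW, Set.image_subset_iff])
    hj.isEmbedding
  -- The kernel of the restriction consists of the cochains vanishing on simplices small for the
  -- open cover `{U, range j}`.
  have hac : (relCochain X {U, Set.range j}).Acyclic := relCochain_acyclic
    (by rintro V (rfl | rfl); exacts [hU, hj.isOpen_range]) (by simpa using h)
  exact HomologicalComplex.HomologySequence.quasiIso_g_of_acyclic hS hac

theorem quasiIso_relMap_empty (f : X ⟶ Y) (h : QuasiIso (cochainFunctor.map f.op)) :
    QuasiIso (relMap f (mapsSmall_empty f ∅)) := by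
  have : relMap f (mapsSmall_empty f ∅) = (relCochainEmptyIso Y).hom ≫
      cochainFunctor.map f.op ≫ (relCochainEmptyIso X).inv := by
    rw [← Category.assoc, ← relCochainEmptyIso_naturality, Category.assoc, Iso.hom_inv_id,
      Category.comp_id]
  rw [this]
  infer_instance

/-- The cochain sequence of the pair given by an embedding. -/
theorem pair_shortExact (j : Y ⟶ X) (hj : Topology.IsEmbedding j) {U : Set X}
    (hU : Set.range j = U) :
    (restrictionSequence j (𝒱 := {U}) (𝒰 := ∅) (𝒲 := ∅)
      (fun s => by simp [isSmall_singleton, hU, not_isSmall_empty])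
      (fun s => by simp [not_isSmall_empty])).ShortExact :=
  restrictionSequence_shortExact _ _ _ hj

theorem relCochain_acyclic_of_quasiIso (j : Y ⟶ X) (hj : Topology.IsEmbedding j) {U : Set X}
    (hU : Set.range j = U) (h : QuasiIso (cochainFunctor.map j.op)) :
    (relCochain X {U}).Acyclic :=
  (pair_shortExact j hj hU).acyclic_X₁ (quasiIso_relMap_empty j h)

/-- A map of pairs which is a quasi-isomorphism on both spaces is one on relative cochains. -/
theorem quasiIso_relMap_pair {A B : TopCat.{u}} (i : A ⟶ X) (hi : Topology.IsEmbedding i)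
    (j : B ⟶ Y) (hj : Topology.IsEmbedding j) (f : X ⟶ Y) (g : A ⟶ B) (w : i ≫ f = g ≫ j)
    {U : Set X} {V : Set Y} (hU : Set.range i = U) (hV : Set.range j = V)
    (hf : QuasiIso (cochainFunctor.map f.op)) (hg : QuasiIso (cochainFunctor.map g.op))
    (hUV : MapsSmall f {U} {V}) : QuasiIso (relMap f hUV) := by
  let φ : restrictionSequence j (𝒱 := {V}) (𝒰 := ∅) (𝒲 := ∅)
      (fun s => by simp [isSmall_singleton, hV, not_isSmall_empty])
      (fun s => by simp [not_isSmall_empty]) ⟶ restrictionSequence i (𝒱 := {U}) (𝒰 := ∅) (𝒲 := ∅)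
      (fun s => by simp [isSmall_singleton, hU, not_isSmall_empty])
      (fun s => by simp [not_isSmall_empty]) :=
    { τ₁ := relMap f hUV
      τ₂ := relMap f (mapsSmall_empty f ∅)
      τ₃ := relMap g (mapsSmall_empty g ∅)
      comm₁₂ := by
        dsimp [restrictionSequence]
        rw [← relMap_comp _ _ _ _ (mapsSmall_empty _ _), ← relMap_comp _ _ _ _ (mapsSmall_empty _ _)]
        simp only [Category.id_comp, Category.comp_id]
      comm₂₃ := by
        dsimp [restrictionSequence]
        rw [← relMap_comp _ _ _ _ (mapsSmall_empty _ _), ← relMap_comp _ _ _ _ (mapsSmall_empty _ _)]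
        simp only [w] }
  exact HomologicalComplex.HomologySequence.quasiIso_τ₁ φ (pair_shortExact j hj hV)
    (pair_shortExact i hi hU) (quasiIso_relMap_empty f hf) (quasiIso_relMap_empty g hg)

/-- A singular cochain of positive degree on a one-point space which is closed is exact. -/
theorem cochainFunctor_exactAt_of_unique (X : TopCat.{u}) [Unique X] (n : ℕ) :
    (cochainFunctor.obj (op X)).ExactAt (n + 1) := by
  have hprev : (ComplexShape.down ℕ).symm.prev (n + 1) = n := ComplexShape.prev_eq' _ rfl
  have hnext : (ComplexShape.down ℕ).symm.next (n + 1) = n + 2 := ComplexShape.next_eq' _ rfl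
  rw [HomologicalComplex.exactAt_iff' _ n (n + 1) (n + 2) hprev hnext,
    ShortComplex.ab_exact_iff]
  intro φ hφ
  -- All `m + 2` faces coincide, so the signs cancel for even `m` and sum to 1 for odd `m`: the
  -- differentials alternate between 0 and the identity.
  have hd : ∀ (m : ℕ) (ψ : (cochainFunctor.obj (op X)).X m) (σ : C(Simplex (m + 1), X))
      (τ : C(Simplex m, X)), ev X (m + 1) ((cochainFunctor.obj (op X)).d m (m + 1) ψ) σ =
        if Even m then 0 else ev X m ψ τ := by
    intro m ψ σ τ
    rw [ev_d]
    have : ∀ i, σ.comp (faceMap i) = τ := fun i => ContinuousMap.ext fun t => Subsingleton.elim _ _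
    simp only [this]
    rw [← Finset.sum_smul, Fin.sum_neg_one_pow]
    by_cases hm : Even m <;> simp [hm, Nat.even_add]
  let τ : C(Simplex n, X) := ContinuousMap.const _ default
  let σ₀ : C(Simplex (n + 1), X) := ContinuousMap.const _ default
  have hσ : ∀ σ, σ = σ₀ := fun σ => ContinuousMap.ext fun t => Subsingleton.elim _ _
  by_cases hn : Even n
  · refine ⟨0, ?_⟩
    rw [map_zero]
    symm
    apply (ev X (n + 1)).injective
    funext σ
    have h1 := hd (n + 1) φ (ContinuousMap.const _ default) σ
    rw [if_neg (by simpa [Nat.even_add_one] using hn)] at h1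
    refine (h1.symm.trans ?_).trans (congrFun (map_zero (ev X (n + 1))) σ).symm
    exact (congrArg (fun θ => ev X (n + 2) θ (ContinuousMap.const _ default)) hφ).trans
      (congrFun (map_zero (ev X (n + 2))) _)
  · refine ⟨(ev X n).symm fun _ => ev X (n + 1) φ σ₀, ?_⟩
    apply (ev X (n + 1)).injective
    funext σ
    refine (hd n _ σ τ).trans ?_
    rw [if_neg hn, AddEquiv.apply_symm_apply, hσ σ]

end SingularCochain

end

/-! ### The suspension isomorphism for `W × ℝ`. -/

noncomputable section

namespace SingularCochain

open CategoryTheory Opposite SimplexSubdivision Limits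

/-- If `D` embeds in `W × ℝ` with image fibrewise star-shaped around the level `c`, then the
retraction of `D` to the level `c` is homotopic to the identity. -/
theorem nonempty_homotopy_of_starShaped {W D : TopCat.{u}} {i : D → W × ℝ}
    (hi : Topology.IsEmbedding i) (c : ℝ)
    (hD : ∀ d, ∀ τ ∈ Set.Icc (0 : ℝ) 1, ((i d).1, (1 - τ) * c + τ * (i d).2) ∈ Set.range i)
    {e : D ⟶ D} (he : ∀ d, i (e d) = ((i d).1, c)) : Nonempty (TopCat.Homotopy e (𝟙 D)) := by
  choose H hH using fun p : unitInterval × D => hD p.2 p.1 p.1.2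
  have hc : Continuous H := by
    rw [hi.continuous_iff]
    have : i ∘ H = fun p : unitInterval × D =>
        ((i p.2).1, (1 - (p.1 : ℝ)) * c + p.1 * (i p.2).2) := funext hH
    rw [this]
    have := hi.continuous
    fun_prop
  refine ⟨⟨⟨H, hc⟩, fun d => hi.injective ?_, fun d => hi.injective ?_⟩⟩
  · refine (hH _).trans ((he d).trans ?_).symm
    simp
  · refine (hH _).trans ?_
    simp

variable {W : TopCat.{u}} (O : Set W)

/-- The complement in `W × ℝ` of `Oᶜ × {0}`. -/
def punctured : Set (W × ℝ) := {p | p.1 ∈ O ∨ p.2 ≠ 0}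

/-- The part of `W × ℝ` above `O` or of positive height. -/
def upperPart : Set (W × ℝ) := {p | p.1 ∈ O ∨ 0 < p.2}

/-- The part of `W × ℝ` above `O` or of negative height. -/
def lowerPart : Set (W × ℝ) := {p | p.1 ∈ O ∨ p.2 < 0}

theorem upperPart_subset_punctured : upperPart O ⊆ punctured O :=
  fun _ => Or.imp_right ne_of_gt

theorem lowerPart_subset_punctured : lowerPart O ⊆ punctured O :=
  fun _ => Or.imp_right ne_of_lt

variable {O}

theorem isOpen_punctured (hO : IsOpen O) : IsOpen (punctured O) :=
  (hO.preimage continuous_fst).union (isOpen_ne.preimage continuous_snd)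

theorem isOpen_upperPart (hO : IsOpen O) : IsOpen (upperPart O) :=
  (hO.preimage continuous_fst).union (isOpen_lt continuous_const continuous_snd)

theorem isOpen_lowerPart (hO : IsOpen O) : IsOpen (lowerPart O) :=
  (hO.preimage continuous_fst).union (isOpen_lt continuous_snd continuous_const)

variable (O)

/-- Both `upperPart O` and `W × ℝ` retract by vertical deformation to the level 1. -/
theorem relCochain_upperPart_acyclic :
    (relCochain (TopCat.of (W × ℝ)) {upperPart O}).Acyclic := by
  let j : TopCat.of (upperPart O) ⟶ TopCat.of (W × ℝ) :=
    TopCat.ofHom ⟨Subtype.val, continuous_subtype_val⟩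
  let g : TopCat.of (W × ℝ) ⟶ TopCat.of (upperPart O) :=
    TopCat.ofHom ⟨fun p => ⟨(p.1, 1), Or.inr one_pos⟩, by fun_prop⟩
  obtain ⟨H⟩ := nonempty_homotopy_of_starShaped (W := W) (D := TopCat.of (upperPart O))
    (i := Subtype.val) Topology.IsEmbedding.subtypeVal 1 (e := j ≫ g) (by
      rintro ⟨⟨w, s⟩, h⟩ τ ⟨h0, h1⟩
      rw [Subtype.range_coe]
      refine h.imp id fun (hs : 0 < s) => ?_
      change 0 < (1 - τ) * 1 + τ * s
      rcases h0.eq_or_lt with rfl | h0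
      · simp
      · nlinarith [mul_pos h0 hs]) (fun d => rfl)
  obtain ⟨K⟩ := nonempty_homotopy_of_starShaped (W := W) (D := TopCat.of (W × ℝ))
    (i := id) Topology.IsEmbedding.id 1 (e := g ≫ j) (fun d τ _ => by simp) (fun d => rfl)
  exact relCochain_acyclic_of_quasiIso j Topology.IsEmbedding.subtypeVal Subtype.range_coe
    (quasiIso_cochainFunctor_map j g H K)

/-- The projection of pairs to `(W, O)` is a homotopy equivalence on each space, with inverse at
level -1 on the lower part and at level 0 over `O`. -/
theorem quasiIso_lowerPart_fst {f : TopCat.of (lowerPart O) ⟶ W} (hf : ∀ p, f p = p.1.1)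
    {U : Set (lowerPart O)} (hU : U = {p | p.1.1 ∈ O}) (h : MapsSmall f {U} {O}) :
    QuasiIso (relMap f h) := by
  let g : W ⟶ TopCat.of (lowerPart O) :=
    TopCat.ofHom ⟨fun w => ⟨(w, -1), Or.inr (by simp)⟩, by fun_prop⟩
  obtain ⟨H⟩ := nonempty_homotopy_of_starShaped (W := W) (D := TopCat.of (lowerPart O))
    (i := Subtype.val) Topology.IsEmbedding.subtypeVal (-1) (e := f ≫ g) (by
      rintro ⟨⟨w, s⟩, h⟩ τ ⟨h0, h1⟩
      rw [Subtype.range_coe]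
      refine h.imp id fun (hs : s < 0) => ?_
      change (1 - τ) * (-1) + τ * s < 0
      rcases h0.eq_or_lt with rfl | h0
      · simp
      · nlinarith [mul_pos h0 (neg_pos.2 hs)]) (fun d => by
        change (f d, (-1 : ℝ)) = _
        rw [hf])
  have hgf : g ≫ f = 𝟙 W := by
    ext w
    exact hf _
  let i : TopCat.of {p : W × ℝ | p.1 ∈ O} ⟶ TopCat.of (lowerPart O) :=
    TopCat.ofHom ⟨fun p => ⟨p.1, Or.inl p.2⟩, by fun_prop⟩
  have hi : Topology.IsEmbedding i :=
    Topology.IsEmbedding.of_comp i.hom.continuous continuous_subtype_val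
      Topology.IsEmbedding.subtypeVal
  let j : TopCat.of O ⟶ W := TopCat.ofHom ⟨Subtype.val, continuous_subtype_val⟩
  let f' : TopCat.of {p : W × ℝ | p.1 ∈ O} ⟶ TopCat.of O :=
    TopCat.ofHom ⟨fun p => ⟨p.1.1, p.2⟩, by fun_prop⟩
  let g' : TopCat.of O ⟶ TopCat.of {p : W × ℝ | p.1 ∈ O} :=
    TopCat.ofHom ⟨fun w => ⟨(w.1, 0), w.2⟩, by fun_prop⟩
  obtain ⟨H'⟩ := nonempty_homotopy_of_starShaped (W := W) (D := TopCat.of {p : W × ℝ | p.1 ∈ O})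
    (i := Subtype.val) Topology.IsEmbedding.subtypeVal 0 (e := f' ≫ g') (by
      rintro ⟨⟨w, s⟩, h⟩ τ _
      rw [Subtype.range_coe]
      exact h) (fun d => rfl)
  refine quasiIso_relMap_pair i hi j Topology.IsEmbedding.subtypeVal f f' ?_ ?_ Subtype.range_coe
    (quasiIso_cochainFunctor_map f g H ?_)
    (quasiIso_cochainFunctor_map f' g' H' (TopCat.Homotopy.refl (𝟙 _))) h
  · ext p
    exact hf _
  · rw [hU]
    ext p
    constructor
    · rintro ⟨q, rfl⟩
      exact q.2
    · intro hp
      exact ⟨⟨p.1, hp⟩, rfl⟩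
  · rw [hgf]
    exact TopCat.Homotopy.refl (𝟙 _)

variable {O}

/-- The relative cohomology of `(W × ℝ, W × ℝ ∖ Oᶜ × {0})` is that of `(W, O)`, shifted by one. -/
theorem suspension (hO : IsOpen O) :
    IsZero ((relCochain (TopCat.of (W × ℝ)) {punctured O}).homology 0) ∧
      ∀ n, Nonempty ((relCochain (TopCat.of (W × ℝ)) {punctured O}).homology (n + 1) ≅
        (relCochain W {O}).homology n) := by
  let j : TopCat.of (punctured O) ⟶ TopCat.of (W × ℝ) :=
    TopCat.ofHom ⟨Subtype.val, continuous_subtype_val⟩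
  have hj : Set.range j = punctured O := Subtype.range_coe
  -- The sequence of the triple `upperPart O ⊆ punctured O ⊆ W × ℝ`. Its middle term is acyclic, so
  -- the connecting map is an isomorphism.
  have hS := restrictionSequence_shortExact j (𝒱 := {punctured O}) (𝒰 := {upperPart O})
    (𝒲 := {j ⁻¹' upperPart O})
    (fun s => by
      rw [isSmall_singleton, isSmall_singleton, hj]
      exact ⟨Or.inr, fun h => h.elim (fun h => h.trans (upperPart_subset_punctured O)) id⟩)
    (fun s => by rw [isSmall_singleton, isSmall_singleton, Set.image_subset_iff])
    Topology.IsEmbedding.subtypeVal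
  have hz : ∀ n, IsZero ((relCochain (TopCat.of (W × ℝ)) {upperPart O}).homology n) := fun n =>
    (relCochain_upperPart_acyclic O n).isZero_homology
  refine ⟨?_, fun n => ?_⟩
  · exact HomologicalComplex.HomologySequence.isZero_homology_X₁ hS 0
      (fun i (h : i + 1 = 0) => absurd h (Nat.succ_ne_zero i)) (hz 0)
  · let k : TopCat.of (lowerPart O) ⟶ TopCat.of (punctured O) :=
      TopCat.ofHom ⟨fun p => ⟨p.1, lowerPart_subset_punctured O p.2⟩, by fun_prop⟩
    have hk : Topology.IsOpenEmbedding k :=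
      Topology.IsOpenEmbedding.of_comp (g := Subtype.val) k
        (isOpen_punctured hO).isOpenEmbedding_subtypeVal
        (isOpen_lowerPart hO).isOpenEmbedding_subtypeVal
    -- The upper and lower parts cover `punctured O` and meet in `O × ℝ`; excision passes to the
    -- lower part.
    have q₁ := quasiIso_relMap_of_isOpenEmbedding k hk (U := j ⁻¹' upperPart O)
      ((isOpen_upperPart hO).preimage j.hom.continuous) (W := k ⁻¹' (j ⁻¹' upperPart O)) rfl (by
        refine Set.eq_univ_of_forall fun p => ?_
        rcases p.2 with h | h
        · exact Or.inl (Or.inl h)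
        · rcases h.lt_or_gt with h | h
          · exact Or.inr ⟨⟨p.1, Or.inr h⟩, rfl⟩
          · exact Or.inl (Or.inr h))
    let f : TopCat.of (lowerPart O) ⟶ W := TopCat.ofHom ⟨fun p => p.1.1, by fun_prop⟩
    have hU : k ⁻¹' (j ⁻¹' upperPart O) = {p : lowerPart O | p.1.1 ∈ O} := by
      ext p
      refine ⟨fun h => ?_, Or.inl⟩
      rcases h with h | h
      · exact h
      · rcases p.2 with h' | h'
        · exact h'
        · exact absurd h (not_lt.2 h'.le)
    have q₂ := quasiIso_lowerPart_fst O (f := f) (fun _ => rfl) hU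
      (mapsSmall_singleton fun p hp => by rw [hU] at hp; exact hp)
    obtain ⟨e₁⟩ := nonempty_homologyIso q₁ n
    obtain ⟨e₂⟩ := nonempty_homologyIso q₂ n
    exact ⟨(hS.δIso n (n + 1) rfl (hz n) (hz (n + 1))).symm ≪≫ e₁ ≪≫ e₂.symm⟩

/-- The homology of `K` is that of `L` shifted up by `k` degrees. -/
def IsHomologyShift (k : ℕ)
    (K L : HomologicalComplex AddCommGrpCat.{u} (ComplexShape.down ℕ).symm) : Prop :=
  (∀ n < k, IsZero (K.homology n)) ∧ ∀ n, Nonempty (K.homology (n + k) ≅ L.homology n)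

theorem IsHomologyShift.suspension (hO : IsOpen O) {k : ℕ}
    {L : HomologicalComplex AddCommGrpCat.{u} (ComplexShape.down ℕ).symm}
    (h : IsHomologyShift k (relCochain W {O}) L) :
    IsHomologyShift (k + 1) (relCochain (TopCat.of (W × ℝ)) {punctured O}) L := by
  obtain ⟨h0, h1⟩ := SingularCochain.suspension hO
  refine ⟨fun n hn => ?_, fun n => ?_⟩
  · cases n with
    | zero => exact h0
    | succ n => exact (h.1 n (Nat.lt_of_succ_lt_succ hn)).of_iso (h1 n).some
  · exact ⟨(h1 (n + k)).some ≪≫ (h.2 n).some⟩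

theorem IsHomologyShift.congr_left {k : ℕ}
    {K K' L : HomologicalComplex AddCommGrpCat.{u} (ComplexShape.down ℕ).symm}
    (h : IsHomologyShift k K L) (e : ∀ n, Nonempty (K'.homology n ≅ K.homology n)) :
    IsHomologyShift k K' L :=
  ⟨fun n hn => (h.1 n hn).of_iso (e n).some, fun n => ⟨(e (n + k)).some ≪≫ (h.2 n).some⟩⟩

/-- The start of the iterated suspension: singular simplices are nonempty, so vanishing on those
inside `∅` is no condition. -/
theorem isHomologyShift_zero_empty (Y : TopCat.{u}) :
    IsHomologyShift 0 (relCochain Y {∅}) (cochainFunctor.obj (op Y)) := by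
  have e : relCochain Y {∅} ≅ relCochain Y ∅ :=
    relIso (Iso.refl Y) (mapsSmall_empty _ _) fun s hs h =>
      absurd (isSmall_singleton.1 h) hs.not_subset_empty
  exact ⟨fun n hn => absurd hn (Nat.not_lt_zero n), fun n =>
    ⟨(HomologicalComplex.homologyFunctor _ _ n).mapIso (e ≪≫ relCochainEmptyIso Y)⟩⟩

end SingularCochain

end

/-! ### The Thom isomorphism for a hyperplane. -/

noncomputable section

namespace QuaternionicArrangement

open CategoryTheory Opposite SingularCochain SimplexSubdivision Limits

section Topology

variable {V : Type u} [AddCommGroup V] [Module ℍ[ℝ] V] [TopologicalSpace V]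
  [ContinuousSMul ℍ[ℝ] V]

theorem continuous_real_smul : Continuous fun p : ℝ × V => (p.1 : ℍ[ℝ]) • p.2 :=
  (Quaternion.continuous_coe.comp continuous_fst).smul continuous_snd

variable [IsTopologicalAddGroup V] in
-- Over `ℝ`, `V` is a finite-dimensional Hausdorff topological vector space, and linear maps out of
-- it are continuous.
theorem continuous_linearMap [Module.Finite ℍ[ℝ] V] [T2Space V] (a : V →ₗ[ℍ[ℝ]] ℍ[ℝ]) :
    Continuous a := by
  let _ : Module ℝ V := Module.compHom V (algebraMap ℝ ℍ[ℝ])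
  have : IsScalarTower ℝ ℍ[ℝ] V := ⟨fun r q v => by
    change (r • q) • v = (algebraMap ℝ ℍ[ℝ] r) • q • v
    rw [smul_smul, Algebra.smul_def]⟩
  have : Module.Finite ℝ V := Module.Finite.trans ℍ[ℝ] V
  have : ContinuousSMul ℝ V := ⟨continuous_real_smul⟩
  exact (a.restrictScalars ℝ).continuous_of_finiteDimensional

variable [IsTopologicalAddGroup V] in
theorem IsHyperplane.isClosed [Module.Finite ℍ[ℝ] V] [T2Space V] {A : Submodule ℍ[ℝ] V}
    (hA : IsHyperplane A) : IsClosed (A : Set V) := by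
  obtain ⟨a, -, rfl⟩ := hA
  exact isClosed_singleton.preimage (continuous_linearMap a)

variable [IsTopologicalAddGroup V] in
theorem Arrangement.isOpen_complement [Module.Finite ℍ[ℝ] V] [T2Space V] (𝒜 : Arrangement V) :
    IsOpen 𝒜.complement :=
  (𝒜.finite.isClosed_biUnion fun A hA => (𝒜.isHyperplane A hA).isClosed).isOpen_compl

/-- The quaternion with given coordinates. -/
def ofCoords (r s t w : ℝ) : ℍ[ℝ] := ⟨r, s, t, w⟩

theorem continuous_ofCoords {T : Type*} [TopologicalSpace T] {r s t w : T → ℝ} (hr : Continuous r)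
    (hs : Continuous s) (ht : Continuous t) (hw : Continuous w) :
    Continuous fun x => ofCoords (r x) (s x) (t x) (w x) := by
  have : (fun x => ofCoords (r x) (s x) (t x) (w x)) = fun x =>
      r x • ofCoords 1 0 0 0 + s x • ofCoords 0 1 0 0 + t x • ofCoords 0 0 1 0 +
        w x • ofCoords 0 0 0 1 := by
    funext x
    ext
    · change r x = r x * 1 + s x * 0 + t x * 0 + w x * 0
      ring
    · change s x = r x * 0 + s x * 1 + t x * 0 + w x * 0
      ring
    · change t x = r x * 0 + s x * 0 + t x * 1 + w x * 0
      ring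
    · change w x = r x * 0 + s x * 0 + t x * 0 + w x * 1
      ring
  rw [this]
  fun_prop

/-- The cohomology of the ambient module vanishes in positive degrees. -/
theorem cochainFunctor_exactAt_module (n : ℕ) :
    (cochainFunctor.obj (op (TopCat.of V))).ExactAt (n + 1) := by
  let f : TopCat.of V ⟶ TopCat.of PUnit.{u + 1} := TopCat.ofHom ⟨fun _ => PUnit.unit, by fun_prop⟩
  let g : TopCat.of PUnit.{u + 1} ⟶ TopCat.of V := TopCat.ofHom ⟨fun _ => 0, by fun_prop⟩
  let H : TopCat.Homotopy (f ≫ g) (𝟙 (TopCat.of V)) :=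
    ⟨⟨fun p => ((p.1 : ℝ) : ℍ[ℝ]) • (p.2 : V), continuous_real_smul.comp
      ((continuous_subtype_val.comp continuous_fst).prodMk continuous_snd)⟩,
      fun v => by simp [f, g], fun v => by simp⟩
  have q := quasiIso_cochainFunctor_map f g H (TopCat.Homotopy.refl (𝟙 _))
  rw [HomologicalComplex.exactAt_iff_isZero_homology]
  have : Unique (TopCat.of PUnit.{u + 1}) := inferInstanceAs (Unique PUnit)
  exact (cochainFunctor_exactAt_of_unique (TopCat.of PUnit.{u + 1}) n).isZero_homology.of_iso
    (nonempty_homologyIso q (n + 1)).some.symm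

end Topology

namespace Arrangement

section Gysin

variable {V : Type u} [AddCommGroup V] [Module ℍ[ℝ] V] (𝒜 : Arrangement V)
  {A : Submodule ℍ[ℝ] V}

theorem mem_complement {v : V} : v ∈ 𝒜.complement ↔ ∀ B ∈ 𝒜.hyperplanes, v ∉ B := by
  simp [complement]

theorem mem_complement_iff_deletion (hA : A ∈ 𝒜.hyperplanes) {v : V} :
    v ∈ 𝒜.complement ↔ v ∈ (𝒜.deletion A).complement ∧ v ∉ A := by
  rw [mem_complement, mem_complement]
  refine ⟨fun h => ⟨fun B hB => h B hB.1, h A hA⟩, fun h B hB => ?_⟩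
  by_cases hBA : B = A
  · exact hBA ▸ h.2
  · exact h.1 B ⟨hB, hBA⟩

theorem mem_complement_restriction (hA : A ∈ 𝒜.hyperplanes) {v : A} :
    v ∈ (𝒜.restriction A hA).complement ↔ (v : V) ∈ (𝒜.deletion A).complement := by
  rw [mem_complement, mem_complement]
  exact ⟨fun h B hB hv => h _ ⟨B, hB, rfl⟩ hv, by rintro h _ ⟨B, hB, rfl⟩ hv; exact h B hB hv⟩

variable [TopologicalSpace V] [IsTopologicalAddGroup V] [ContinuousSMul ℍ[ℝ] V]
  [Module.Finite ℍ[ℝ] V] [T2Space V]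

/-- The relative cohomology of the complement of the deletion modulo the complement of the
arrangement is the cohomology of the complement of the restriction, shifted by four. -/
theorem isHomologyShift_relCochain (hA : A ∈ 𝒜.hyperplanes) :
    IsHomologyShift 4 (relCochain (𝒜.deletion A).space {Set.range (𝒜.inclusion A)})
      (cochainFunctor.obj (op (𝒜.restriction A hA).space)) := by
  obtain ⟨a, ha, haA⟩ := 𝒜.isHyperplane A hA
  have hmem : ∀ v, v ∈ A ↔ a v = 0 := fun v => by rw [← haA, LinearMap.mem_ker]
  obtain ⟨v₁, hv₁⟩ : ∃ v, a v ≠ 0 := by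
    by_contra! h
    exact ha (LinearMap.ext h)
  obtain ⟨v₀, hv₀⟩ : ∃ v, a v = 1 := ⟨(a v₁)⁻¹ • v₁, by simp [hv₁]⟩
  have hac : Continuous a := continuous_linearMap a
  -- The projection along the line `ℍ v₀`; together with the four coordinates of `a` it identifies
  -- `V` with `A × ℝ⁴`.
  let π : V → A := fun v => ⟨v - a v • v₀, by simp [hmem, hv₀]⟩
  have hπ : Continuous π := by fun_prop
  have hπA : ∀ v ∈ A, (π v : V) = v := fun v hv => by simp [π, (hmem v).1 hv]
  let e : V ≃ₜ (((A × ℝ) × ℝ) × ℝ) × ℝ :=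
    { toFun := fun v => ((((π v, (a v).re), (a v).imI), (a v).imJ), (a v).imK)
      invFun := fun p => (p.1.1.1.1 : V) + ofCoords p.1.1.1.2 p.1.1.2 p.1.2 p.2 • v₀
      left_inv := fun v => by
        change v - a v • v₀ + a v • v₀ = v
        exact sub_add_cancel _ _
      right_inv := fun p => by
        have h0 : a (p.1.1.1.1 : V) = 0 := (hmem _).1 p.1.1.1.1.2
        have h1 : a ((p.1.1.1.1 : V) + ofCoords p.1.1.1.2 p.1.1.2 p.1.2 p.2 • v₀) =
            ofCoords p.1.1.1.2 p.1.1.2 p.1.2 p.2 := by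
          rw [map_add, h0, map_smul, hv₀, zero_add, smul_eq_mul, mul_one]
        simp [π, h1]
        simp [ofCoords]
      continuous_toFun := by
        have h1 := Quaternion.continuous_re.comp hac
        have h2 := Quaternion.continuous_imI.comp hac
        have h3 := Quaternion.continuous_imJ.comp hac
        have h4 := Quaternion.continuous_imK.comp hac
        exact (((hπ.prodMk h1).prodMk h2).prodMk h3).prodMk h4
      continuous_invFun := by
        have h : Continuous fun p : (((A × ℝ) × ℝ) × ℝ) × ℝ =>
            ofCoords p.1.1.1.2 p.1.1.2 p.1.2 p.2 :=
          continuous_ofCoords (by fun_prop) (by fun_prop) (by fun_prop) (by fun_prop)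
        have h' : Continuous fun p : (((A × ℝ) × ℝ) × ℝ) × ℝ => (p.1.1.1.1 : V) := by fun_prop
        exact h'.add (h.smul continuous_const) }
  let Y : TopCat.{u} := (𝒜.restriction A hA).space
  let W : TopCat.{u} := TopCat.of ((((Y × ℝ) × ℝ) × ℝ) × ℝ)
  -- Puncturing four times, starting from `∅`, gives `Y × (ℝ⁴ ∖ 0)`.
  let O : Set W := punctured (W := TopCat.of (((Y × ℝ) × ℝ) × ℝ))
    (punctured (W := TopCat.of ((Y × ℝ) × ℝ)) (punctured (W := TopCat.of (Y × ℝ))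
      (punctured (W := Y) ∅)))
  have hO₁ : IsOpen (punctured (W := Y) ∅) := isOpen_punctured isOpen_empty
  have hO₂ := isOpen_punctured (W := TopCat.of (Y × ℝ)) hO₁
  have hO₃ := isOpen_punctured (W := TopCat.of ((Y × ℝ) × ℝ)) hO₂
  have hO : IsOpen O := isOpen_punctured (W := TopCat.of (((Y × ℝ) × ℝ) × ℝ)) hO₃
  have hshift : IsHomologyShift 4 (relCochain W {O}) (cochainFunctor.obj (op Y)) :=
    (((((isHomologyShift_zero_empty Y).suspension isOpen_empty).suspension hO₁).suspension
      hO₂).suspension hO₃)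
  -- This set plays the role of a tubular neighbourhood: it is open both in `X'` and in `X'' × ℝ⁴`,
  -- and excision applies to either inclusion.
  let N : TopCat.{u} :=
    TopCat.of {v : V | v ∈ (𝒜.deletion A).complement ∧ π v ∈ (𝒜.restriction A hA).complement}
  have hNo : IsOpen {v : V | v ∈ (𝒜.deletion A).complement ∧
      π v ∈ (𝒜.restriction A hA).complement} :=
    (𝒜.deletion A).isOpen_complement.inter
      ((𝒜.restriction A hA).isOpen_complement.preimage hπ)
  let j₁ : N ⟶ (𝒜.deletion A).space := TopCat.ofHom ⟨fun v => ⟨v.1, v.2.1⟩, by fun_prop⟩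
  have hj₁ : Topology.IsOpenEmbedding j₁ :=
    Topology.IsOpenEmbedding.of_comp (g := Subtype.val) j₁
      (𝒜.deletion A).isOpen_complement.isOpenEmbedding_subtypeVal hNo.isOpenEmbedding_subtypeVal
  let j₂ : N ⟶ W := TopCat.ofHom ⟨fun v => (((((⟨π v.1, v.2.2⟩ : (𝒜.restriction A hA).complement),
      (a v.1).re), (a v.1).imI), (a v.1).imJ), (a v.1).imK), by
    have hac' : Continuous fun v : N => a v.1 := hac.comp continuous_subtype_val
    have h1 := Quaternion.continuous_re.comp hac'
    have h2 := Quaternion.continuous_imI.comp hac'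
    have h3 := Quaternion.continuous_imJ.comp hac'
    have h4 := Quaternion.continuous_imK.comp hac'
    exact (((((hπ.comp continuous_subtype_val).subtype_mk _).prodMk h1).prodMk h2).prodMk
      h3).prodMk h4⟩
  have hj₂ : Topology.IsOpenEmbedding j₂ := by
    have hY : Topology.IsOpenEmbedding (Subtype.val : (𝒜.restriction A hA).complement → A) :=
      (𝒜.restriction A hA).isOpen_complement.isOpenEmbedding_subtypeVal
    have hid : Topology.IsOpenEmbedding (id : ℝ → ℝ) := Topology.IsOpenEmbedding.id
    exact Topology.IsOpenEmbedding.of_comp j₂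
      ((((hY.prodMap hid).prodMap hid).prodMap hid).prodMap hid)
      (e.isOpenEmbedding.comp hNo.isOpenEmbedding_subtypeVal)
  have hOiff : ∀ v : N, j₂ v ∈ O ↔ a v.1 ≠ 0 := fun v => by
    rw [ne_eq, Quaternion.ext_iff]
    change ((((False ∨ (a v.1).re ≠ 0) ∨ (a v.1).imI ≠ 0) ∨ (a v.1).imJ ≠ 0) ∨
      (a v.1).imK ≠ 0) ↔ _
    simp only [Quaternion.re_zero, Quaternion.imI_zero, Quaternion.imJ_zero, Quaternion.imK_zero]
    tauto
  have hrange : ∀ x : (𝒜.deletion A).complement,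
      x ∈ Set.range (𝒜.inclusion A) ↔ a x.1 ≠ 0 := fun x => by
    constructor
    · rintro ⟨y, rfl⟩
      exact fun h => ((𝒜.mem_complement_iff_deletion hA).1 y.2).2 ((hmem _).2 h)
    · intro h
      exact ⟨⟨x.1, (𝒜.mem_complement_iff_deletion hA).2 ⟨x.2, fun h' => h ((hmem _).1 h')⟩⟩, rfl⟩
  have hXo : IsOpen (Set.range (𝒜.inclusion A)) := by
    have : Set.range (𝒜.inclusion A) =
        {x : (𝒜.deletion A).complement | a x.1 ≠ 0} := Set.ext hrange
    rw [this]
    exact isOpen_ne.preimage (hac.comp continuous_subtype_val)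
  have hpre : j₂ ⁻¹' O = j₁ ⁻¹' Set.range (𝒜.inclusion A) :=
    Set.ext fun v => (hOiff v).trans (hrange ⟨v.1, v.2.1⟩).symm
  -- As `π` fixes `A`, the set `N` contains all of `X' ∩ A`, which is what both excisions require.
  have hself : ∀ v ∈ A, v ∈ (𝒜.deletion A).complement → π v ∈ (𝒜.restriction A hA).complement :=
    fun v hv h => (𝒜.mem_complement_restriction hA).2 (by rwa [hπA v hv])
  have q₁ := quasiIso_relMap_of_isOpenEmbedding j₁ hj₁ hXo rfl (by
    refine Set.eq_univ_of_forall fun x => ?_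
    by_cases h : a x.1 = 0
    · exact Or.inr ⟨⟨x.1, x.2, hself _ ((hmem _).2 h) x.2⟩, rfl⟩
    · exact Or.inl ((hrange x).2 h))
  have q₂ := quasiIso_relMap_of_isOpenEmbedding j₂ hj₂ hO hpre.symm (by
    refine Set.eq_univ_of_forall fun p => ?_
    obtain ⟨⟨⟨⟨y, r⟩, s⟩, t⟩, w⟩ := p
    by_cases h : r = 0 ∧ s = 0 ∧ t = 0 ∧ w = 0
    · obtain ⟨rfl, rfl, rfl, rfl⟩ := h
      have hy := (𝒜.mem_complement_restriction hA).1 y.2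
      have hay : a (y.1 : V) = 0 := (hmem _).1 y.1.2
      refine Or.inr ⟨⟨y.1, hy, hself _ y.1.2 hy⟩, ?_⟩
      have hy' : (⟨π (y.1 : V), hself _ y.1.2 hy⟩ : (𝒜.restriction A hA).complement) = y :=
        Subtype.ext (Subtype.ext (hπA _ y.1.2))
      change (((((⟨π (y.1 : V), hself _ y.1.2 hy⟩ : (𝒜.restriction A hA).complement),
        (a (y.1 : V)).re), (a (y.1 : V)).imI), (a (y.1 : V)).imJ), (a (y.1 : V)).imK) = _
      rw [hy', hay]
      rfl
    · refine Or.inl ?_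
      change (((False ∨ r ≠ 0) ∨ s ≠ 0) ∨ t ≠ 0) ∨ w ≠ 0
      tauto)
  exact hshift.congr_left fun n =>
    ⟨(nonempty_homologyIso q₁ n).some ≪≫ (nonempty_homologyIso q₂ n).some.symm⟩

end Gysin

end Arrangement

end QuaternionicArrangement

end

/-! ### Splitting the long exact sequence, and the induction. -/

noncomputable section

namespace QuaternionicArrangement

open CategoryTheory Opposite SingularCochain SimplexSubdivision Limits

theorem isZero_singularCohomology_of_neg {i : ℤ} (hi : i < 0) (X : TopCat.{u}) :
    IsZero ((singularCohomology i).obj (op X)) := by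
  cases i with
  | ofNat n => exact absurd hi (not_lt.2 (Int.natCast_nonneg n))
  | negSucc n => exact AddCommGrpCat.isZero_of_subsingleton (AddCommGrpCat.of PUnit)

/-- A short exact sequence may be transported along isomorphisms of its terms. -/
theorem exists_shortExact_of_iso {C : Type*} [Category* C] [Preadditive C] {S : ShortComplex C}
    (hS : S.ShortExact) {X₁ X₂ X₃ : C} (e₁ : S.X₁ ≅ X₁) (e₂ : S.X₂ ≅ X₂) (e₃ : S.X₃ ≅ X₃)
    (f : X₁ ⟶ X₂) (h : e₁.hom ≫ f = S.f ≫ e₂.hom) :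
    ∃ (σ : X₂ ⟶ X₃) (w : f ≫ σ = 0), (ShortComplex.mk f σ w).ShortExact := by
  refine ⟨e₂.inv ≫ S.g ≫ e₃.hom, ?_, ?_⟩
  · rw [← cancel_epi e₁.hom, ← Category.assoc, h]
    simp
  · exact ShortComplex.shortExact_of_iso (ShortComplex.isoMk e₁ e₂ e₃ h (by simp)) hS

namespace Arrangement

variable {V : Type u} [AddCommGroup V] [Module ℍ[ℝ] V] [TopologicalSpace V]

/-- The cohomology of the complement is concentrated in degrees divisible by three and at most
three times the rank. -/
def IsConcentrated (𝒜 : Arrangement V) : Prop :=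
  ∀ i : ℤ, (¬ (3 ∣ i) ∨ i < 0 ∨ 3 * (Module.finrank ℍ[ℝ] V : ℤ) < i) →
    IsZero ((singularCohomology i).obj (op 𝒜.space))

theorem isEmbedding_inclusion (𝒜 : Arrangement V) (A : Submodule ℍ[ℝ] V) :
    Topology.IsEmbedding (𝒜.inclusion A) :=
  Topology.IsEmbedding.inclusion (𝒜.complement_subset_deletion A)

variable [ContinuousSMul ℍ[ℝ] V]

theorem isConcentrated_of_isEmpty {𝒜 : Arrangement V} (h : 𝒜.hyperplanes = ∅) :
    𝒜.IsConcentrated := by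
  intro i hi
  rcases lt_or_ge i 0 with h0 | h0
  · exact isZero_singularCohomology_of_neg h0 _
  obtain ⟨n, rfl⟩ := Int.eq_ofNat_of_zero_le h0
  -- Degree 0 is never among the degrees allowed by `hi`.
  cases n with
  | zero => exact absurd hi (by simp)
  | succ n =>
    have hu : 𝒜.complement = Set.univ := by simp [complement, h]
    let f : 𝒜.space ≅ TopCat.of V :=
      TopCat.isoOfHomeo ((Homeomorph.setCongr hu).trans (Homeomorph.Set.univ V))
    exact (cochainFunctor_exactAt_module (V := V) n).isZero_homology.of_iso
      ((singularCohomologyNat (n + 1)).mapIso f.op).symm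

variable [IsTopologicalAddGroup V] [Module.Finite ℍ[ℝ] V] [T2Space V]

/-- The short exact sequence of a triple of arrangements. -/
theorem exists_shortExact {𝒜 : Arrangement V} {A : Submodule ℍ[ℝ] V} (hA : A ∈ 𝒜.hyperplanes)
    (h' : (𝒜.deletion A).IsConcentrated) (h'' : (𝒜.restriction A hA).IsConcentrated) (i : ℤ) :
    ∃ (σ : (singularCohomology i).obj (op 𝒜.space) ⟶
        (singularCohomology (i - 3)).obj (op (𝒜.restriction A hA).space))
      (w : (singularCohomology i).map (𝒜.inclusion A).op ≫ σ = 0),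
      (ShortComplex.mk ((singularCohomology i).map (𝒜.inclusion A).op) σ w).ShortExact := by
  rcases lt_or_ge i 0 with hi | hi
  · have z₁ := isZero_singularCohomology_of_neg hi (𝒜.deletion A).space
    have z₂ := isZero_singularCohomology_of_neg hi 𝒜.space
    have z₃ := isZero_singularCohomology_of_neg (show i - 3 < 0 by lia)
      (𝒜.restriction A hA).space
    refine ⟨0, comp_zero, ?_⟩
    have : Mono ((singularCohomology i).map (𝒜.inclusion A).op) :=
      ⟨fun _ _ _ => z₁.eq_of_tgt _ _⟩
    have : Epi (0 : (singularCohomology i).obj (op 𝒜.space) ⟶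
        (singularCohomology (i - 3)).obj (op (𝒜.restriction A hA).space)) :=
      ⟨fun _ _ _ => z₃.eq_of_src _ _⟩
    exact ⟨ShortComplex.exact_of_isZero_X₂ _ z₂⟩
  obtain ⟨n, rfl⟩ := Int.eq_ofNat_of_zero_le hi
  have hshift := 𝒜.isHomologyShift_relCochain hA
  have hS := pair_shortExact (𝒜.inclusion A) (𝒜.isEmbedding_inclusion A) rfl
  -- Divisibility by 3 kills the target when `3 ∤ m`, and otherwise the source `H^{m-4}(X'')`, which
  -- is zero also for `m < 4`.
  have hzero : ∀ m, HomologicalComplex.homologyMap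
      (restrictionSequence (𝒜.inclusion A) (𝒱 := {Set.range (𝒜.inclusion A)}) (𝒰 := ∅) (𝒲 := ∅)
      (fun s => by simp [isSmall_singleton, not_isSmall_empty])
      (fun s => by simp [not_isSmall_empty])).f m = 0 := by
    intro m
    by_cases hm : (3 : ℤ) ∣ m
    · refine IsZero.eq_of_src ?_ _ _
      rcases lt_or_ge m 4 with h4 | h4
      · exact hshift.1 m h4
      · obtain ⟨k, rfl⟩ := Nat.exists_eq_add_of_le' h4
        exact (h'' (k : ℤ) (Or.inl (by push_cast at hm; lia))).of_iso (hshift.2 k).some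
    · exact IsZero.eq_of_tgt ((h' (m : ℤ) (Or.inl hm)).of_iso
        ((HomologicalComplex.homologyFunctor _ _ m).mapIso
          (relCochainEmptyIso (𝒜.deletion A).space))) _ _
  -- The connecting map raises the degree by 1 and the Thom isomorphism lowers it by 4, whence `n -
  -- 3`; for `n < 3` both groups are zero.
  obtain ⟨e⟩ : Nonempty ((relCochain (𝒜.deletion A).space
      {Set.range (𝒜.inclusion A)}).homology (n + 1) ≅
      (singularCohomology ((n : ℤ) - 3)).obj (op (𝒜.restriction A hA).space)) := by
    rcases lt_or_ge n 3 with h3 | h3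
    · exact ⟨(hshift.1 (n + 1) (by lia)).iso (isZero_singularCohomology_of_neg (by lia) _)⟩
    · obtain ⟨k, rfl⟩ := Nat.exists_eq_add_of_le' h3
      rw [show ((k + 3 : ℕ) : ℤ) - 3 = (k : ℤ) by push_cast; ring]
      exact hshift.2 k
  have hmono := (hS.homology_exact₂ n).mono_g (hzero n)
  have hepi := (hS.homology_exact₁ n (n + 1) rfl).epi_f (hzero (n + 1))
  have hT : (ShortComplex.mk _ _ (hS.comp_δ n (n + 1) rfl)).ShortExact :=
    { exact := hS.homology_exact₃ n (n + 1) rfl, mono_f := hmono, epi_g := hepi }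
  let e₂ : (relCochain (𝒜.deletion A).space ∅).homology n ≅
      (singularCohomology (n : ℤ)).obj (op (𝒜.deletion A).space) :=
    (HomologicalComplex.homologyFunctor _ _ n).mapIso (relCochainEmptyIso (𝒜.deletion A).space)
  let e₃ : (relCochain 𝒜.space ∅).homology n ≅ (singularCohomology (n : ℤ)).obj (op 𝒜.space) :=
    (HomologicalComplex.homologyFunctor _ _ n).mapIso (relCochainEmptyIso 𝒜.space)
  have hcomm : e₂.hom ≫ (singularCohomology (n : ℤ)).map (𝒜.inclusion A).op =
      HomologicalComplex.homologyMap (relMap (𝒜.inclusion A) (mapsSmall_empty _ ∅)) n ≫ e₃.hom := by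
    exact (HomologicalComplex.homologyMap_comp _ _ n).symm.trans ((congrArg
      (fun g => HomologicalComplex.homologyMap g n)
      (relCochainEmptyIso_naturality (𝒜.inclusion A)).symm).trans
      (HomologicalComplex.homologyMap_comp _ _ n))
  exact exists_shortExact_of_iso hT e₂ e₃ e _ hcomm

end Arrangement

theorem finrank_add_one_of_isHyperplane {V : Type u} [AddCommGroup V] [Module ℍ[ℝ] V]
    [Module.Finite ℍ[ℝ] V] {A : Submodule ℍ[ℝ] V} (hA : IsHyperplane A) :
    Module.finrank ℍ[ℝ] A + 1 = Module.finrank ℍ[ℝ] V := by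
  obtain ⟨a, ha, rfl⟩ := hA
  have hs : LinearMap.range a = ⊤ := LinearMap.range_eq_top.2 (LinearMap.surjective ha)
  have := a.finrank_range_add_finrank_ker
  rw [hs, finrank_top, Module.finrank_self] at this
  lia

namespace Arrangement

/-- The induction on the number of hyperplanes runs over all modules at once, because the
restriction lives in `A`. Distinct hyperplanes may have the same trace on `A`, so the restriction
has at most as many hyperplanes as the deletion. -/
theorem isConcentrated {V : Type u} [AddCommGroup V] [Module ℍ[ℝ] V] [Module.Finite ℍ[ℝ] V]
    [TopologicalSpace V] [T2Space V] [IsTopologicalAddGroup V] [ContinuousSMul ℍ[ℝ] V]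
    (𝒜 : Arrangement V) : 𝒜.IsConcentrated := by
  induction hn : 𝒜.hyperplanes.ncard using Nat.strong_induction_on generalizing V with
  | _ n ih =>
  rcases 𝒜.hyperplanes.eq_empty_or_nonempty with h | ⟨A, hA⟩
  · exact isConcentrated_of_isEmpty h
  have h1 : (𝒜.deletion A).hyperplanes.ncard < n :=
    hn ▸ Set.ncard_sdiff_singleton_lt_of_mem hA 𝒜.finite
  have h2 : (𝒜.restriction A hA).hyperplanes.ncard < n :=
    (Set.ncard_image_le (𝒜.deletion A).finite).trans_lt h1
  have h' := ih _ h1 (𝒜.deletion A) rfl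
  have h'' := ih _ h2 (𝒜.restriction A hA) rfl
  intro i hi
  obtain ⟨σ, w, hσ⟩ := exists_shortExact hA h' h'' i
  have hd := finrank_add_one_of_isHyperplane (𝒜.isHyperplane A hA)
  exact hσ.exact.isZero_X₂ ((h' i hi).eq_of_src _ _) ((h'' (i - 3) (by lia)).eq_of_tgt _ _)

end Arrangement

end QuaternionicArrangement

end

theorem mainTheorem3 {V : Type u} [AddCommGroup V] [Module ℍ[ℝ] V] [Module.Finite ℍ[ℝ] V]
    [TopologicalSpace V] [T2Space V] [IsTopologicalAddGroup V] [ContinuousSMul ℍ[ℝ] V]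
    (𝒜 : QuaternionicArrangement.Arrangement V) :
    (∀ (A : Submodule ℍ[ℝ] V) (hA : A ∈ 𝒜.hyperplanes) (i : ℤ),
      ∃ (σ : (QuaternionicArrangement.singularCohomology i).obj (Opposite.op 𝒜.space) ⟶
          (QuaternionicArrangement.singularCohomology (i - 3)).obj
            (Opposite.op (𝒜.restriction A hA).space))
        (w : CategoryTheory.CategoryStruct.comp
          ((QuaternionicArrangement.singularCohomology i).map (𝒜.inclusion A).op) σ = 0),
        (CategoryTheory.ShortComplex.mk
          ((QuaternionicArrangement.singularCohomology i).map (𝒜.inclusion A).op)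
          σ w).ShortExact) ∧
    (∀ i : ℤ, (¬ (3 ∣ i) ∨ i < 0 ∨ 3 * (Module.finrank ℍ[ℝ] V : ℤ) < i) →
      CategoryTheory.Limits.IsZero
        ((QuaternionicArrangement.singularCohomology i).obj (Opposite.op 𝒜.space))) :=
  ⟨fun A hA => QuaternionicArrangement.Arrangement.exists_shortExact hA
    (𝒜.deletion A).isConcentrated (𝒜.restriction A hA).isConcentrated, 𝒜.isConcentrated⟩
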